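/- **Setting.** Let $0<T<\infty$ and let $q,r$ be complex-valued $C^2$ functions on $\bar\Omega=\{x\ge 0,\ 0\le t\le T\}$ which solve $$iq_t+\tfrac{1}{\sqrt3}q_{xx}+2irr_x=0,\qquad ir_t-\tfrac1{\sqrt3}r_{xx}+2iqq_x=0\qquad (x>0,\ 0<t<T)$$ and decay as $x\to\infty$: there is $\varphi\in L^1(0,\infty)$ with $\varphi(x)\to0$ as $x\to\infty$ and $|q|,|r|,|q_x|,|r_x|\le\varphi(x)$ on $\bar\Omega$. Put $\omega=e^{2\pi i/3}$, $J=\mathrm{diag}(1,\omega^2,\omega)$, $\mathcal L=kJ=\mathrm{diag}(l_1,l_2,l_3)$, $\mathcal Z=-k^2J^2=\mathrm{diag}(z_1,z_2,z_3)$, $$V_1=\begin{pmatrix}0&q&r\\ r&0&q\\ q&r&0\end{pmatrix},\qquad V_2=k\begin{pmatrix}0&\omega q&\omega^2r\\ \omega r&0&q\\ \omega^2q&r&0\end{pmatrix}+\frac{i}{\sqrt3}\begin{pmatrix}0&q_x&-r_x\\ -r_x&0&q_x\\ q_x&-r_x&0\end{pmatrix}-\begin{pmatrix}0&r^2&q^2\\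 q^2&0&r^2\\ r^2&q^2&0\end{pmatrix}.$$ Let $\gamma_1,\gamma_2,\gamma_3$ be the contours $(0,T)\to(0,t)\to(x,t)$, $(0,0)\to(0,t)\to(x,t)$ and $(\infty,t)\to(x,t)$, and let $\hat{\mathcal L}X=[\mathcal L,X]$, $\hat{\mathcal Z}X=[\mathcal Z,X]$. For $j=1,3$ let $\mu_j(x,t,k)$ be the solution on $\bar\Omega$ of $$\mu_x-[\mathcal L,\mu]=V_1\mu,\qquad \mu_t-[\mathcal Z,\mu]=V_2\mu \tag{1}$$ which satisfies $$\mu_j=I+\int_{\gamma_j}e^{\hat{\mathcal L}(x-x')+\hat{\mathcal Z}(t-t')}(V_1dx'+V_2dt')\mu_j .$$ Let $\mu_3^A$ be the solution of $\mu_x+[\mathcal L,\mu]=-V_1^T\mu$, $\mu_t+[\mathcal Z,\mu]=-V_2^T\mu$ which satisfies $$\mu_3^A=I-\int_{\gamma_3}e^{-\hat{\mathcal L}(x-x')-\hat{\mathcal Z}(t-t')}(V_1^Tdx'+V_2^Tdt')\mu_3^A .$$ The twelve sets $D_n\subset\mathbb C$ are the open sectors $\frac{(n-1)\pi}6<\arg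 k<\frac{n\pi}6$, $n=1,\dots,12$; on each of them the numbers $\mathrm{Re}\,l_j(k)$ are distinct and in a fixed order, and so are the numbers $\mathrm{Re}\,z_j(k)$. Let $\mathcal S=D_1\cup D_2\cup D_3\cup D_4$ and $\hat{\mathcal S}=-\mathcal S$. While $\mu_1$ is defined for all $k\in\mathbb C$, the $j$-th column of $\mu_3$ is defined, as a bounded solution, for $k\in\omega^j\mathcal S$, and that of $\mu_3^A$ for $k\in\omega^j\hat{\mathcal S}$. Set $$S(k)=\mu_1(0,0,k),\qquad s(k)=\mu_3(0,0,k),\qquad s^A(k)=\mu_3^A(0,0,k).$$ For a $3\times3$ matrix $X$, $m_{ij}(X)$ is the minor obtained by deleting row $i$ and column $j$; the minors of $s$ are the entries of its cofactor matrix $s^A$ up to sign, $m_{ij}(s)=(-1)^{i+j}(s^A)_{ij}$. For $k\in D_n$ let $M_n(x,t,k)$ be the bounded solution on $\bar\Omega$ of (1) which satisfies, for $i,j=1,2,3$, $$(M_n)_{ij}(x,t,k)=\delta_{ij}+\int_{\gamma^n_{ij}}\Big(e^{\hat{\mathcal L}(x-x')+\hat{\mathcal Z}(t-t')}(V_1dx'+V_2dt')M_n\Big)_{ij},$$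 where $\gamma_{ij}^n=\gamma_1$ if $\mathrm{Re}\,l_i<\mathrm{Re}\,l_j$ and $\mathrm{Re}\,z_i\ge\mathrm{Re}\,z_j$; $\gamma_{ij}^n=\gamma_2$ if $\mathrm{Re}\,l_i<\mathrm{Re}\,l_j$ and $\mathrm{Re}\,z_i<\mathrm{Re}\,z_j$; $\gamma_{ij}^n=\gamma_3$ if $\mathrm{Re}\,l_i\ge\mathrm{Re}\,l_j$. Call $k\in D_n$ regular if this problem has exactly one bounded solution, and set $S_n(k)=M_n(0,0,k)$ for regular $k\in D_n$. **Proposition.** Define $$W_1=S_{11}m_{11}(s)-S_{21}m_{21}(s)+S_{31}m_{31}(s),\qquad W_2=m_{11}(s)m_{22}(S)-m_{21}(s)m_{12}(S),$$ $$W_3=m_{22}(s)m_{11}(S)-m_{12}(s)m_{21}(S),\qquad W_4=-S_{12}m_{12}(s)+S_{22}m_{22}(s)-S_{32}m_{32}(s).$$ Then $W_1=(S^Ts^A)_{11}$ and $W_4=(S^Ts^A)_{22}$. For $n=1,\dots,4$ and every regular $k\in D_n$, $s_{33}(k)\ne0$, $W_n(k)\neq0$ and $$S_1=\begin{pmatrix}\frac{S_{11}}{W_1}&\frac{m_{21}(s)}{s_{33}}&s_{13}\\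 \frac{S_{21}}{W_1}&\frac{m_{11}(s)}{s_{33}}&s_{23}\\ \frac{S_{31}}{W_1}&0&s_{33}\end{pmatrix},\qquad S_2=\begin{pmatrix}\frac{m_{22}(S)}{W_2}&\frac{m_{21}(s)}{s_{33}}&s_{13}\\ \frac{m_{12}(S)}{W_2}&\frac{m_{11}(s)}{s_{33}}&s_{23}\\ 0&0&s_{33}\end{pmatrix},$$ $$S_3=\begin{pmatrix}\frac{m_{22}(s)}{s_{33}}&\frac{m_{21}(S)}{W_3}&s_{13}\\ \frac{m_{12}(s)}{s_{33}}&\frac{m_{11}(S)}{W_3}&s_{23}\\ 0&0&s_{33}\end{pmatrix},\qquad S_4=\begin{pmatrix}\frac{m_{22}(s)}{s_{33}}&\frac{S_{12}}{W_4}&s_{13}\\ \frac{m_{12}(s)}{s_{33}}&\frac{S_{22}}{W_4}&s_{23}\\ 0&\frac{S_{32}}{W_4}&s_{33}\end{pmatrix}.$$ Moreover, with the index $n$ taken modulo $12$ and $\mathcal A=\begin{pmatrix}0&1&0\\0&0&1\\1&0&0\end{pmatrix}$: for $n=1,\dots,12$, $k\in D_n$ if and only if $\omega k\in D_{n+4}$,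 in that case $k$ is regular if and only if $\omega k$ is, and for every regular $k\in D_n$ $$S_n(k)=\mathcal A\,S_{n+4}(\omega k)\,\mathcal A^{-1}.$$ Consequently, for $n=1,\dots,4$: $S_{n+4}(k)=\mathcal A^{-1}S_n(\omega^{-1}k)\mathcal A$ for every regular $k\in D_{n+4}$, and $S_{n+8}(k)=\mathcal A^{-2}S_n(\omega^{-2}k)\mathcal A^2$ for every regular $k\in D_{n+8}$. -/

import Mathlib

noncomputable section

namespace Lax3

open Set

/-- Complex `3 × 3` matrices; the indices `1, 2, 3` are `0, 1, 2 : Fin 3`. -/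
abbrev Mat := Matrix (Fin 3) (Fin 3) ℂ

/-- `ω = e^{2πi/3}`. -/
def ω : ℂ := Complex.exp (2 * Real.pi * Complex.I / 3)

/-- The diagonal of `J = diag(1, ω², ω)`. -/
def Jdiag : Fin 3 → ℂ := ![1, ω ^ 2, ω]

/-- `l_j(k)`, the diagonal entries of `𝓛 = kJ`. -/
def l (k : ℂ) (j : Fin 3) : ℂ := k * Jdiag j

/-- `z_j(k)`, the diagonal entries of `𝓩 = -k²J²`. -/
def z (k : ℂ) (j : Fin 3) : ℂ := -(k ^ 2 * Jdiag j ^ 2)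

/-- The matrix of the `ℤ₃` symmetry. -/
def A : Mat := !![0, 1, 0; 0, 0, 1; 1, 0, 0]

/-! ### The initial-boundary value problem -/

/-- `∂f/∂x` on `{x ≥ 0}`, one-sided at `x = 0`. -/
def dx (f : ℝ → ℝ → ℂ) (x t : ℝ) : ℂ := derivWithin (fun y => f y t) (Ici 0) x

/-- `∂f/∂t` on `{0 ≤ t ≤ T}`, one-sided at the end points. -/
def dt (T : ℝ) (f : ℝ → ℝ → ℂ) (x t : ℝ) : ℂ := derivWithin (fun s => f x s) (Icc 0 T) t

/-- `(q, r)` is a sufficiently smooth and decaying solution of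
`i q_t + q_xx / √3 + 2 i r r_x = 0`, `i r_t - r_xx / √3 + 2 i q q_x = 0`
on the half-line domain `0 < x < ∞`, `0 < t < T`. -/
structure IsSolution (T : ℝ) (q r : ℝ → ℝ → ℂ) : Prop where
  smooth_q : ContDiffOn ℝ 2 (fun p : ℝ × ℝ => q p.1 p.2) (Ici 0 ×ˢ Icc 0 T)
  smooth_r : ContDiffOn ℝ 2 (fun p : ℝ × ℝ => r p.1 p.2) (Ici 0 ×ˢ Icc 0 T)
  eq_q : ∀ x t, 0 < x → t ∈ Ioo 0 T →
    Complex.I * dt T q x t + 1 / (Real.sqrt 3 : ℂ) * dx (dx q) x t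
      + 2 * Complex.I * r x t * dx r x t = 0
  eq_r : ∀ x t, 0 < x → t ∈ Ioo 0 T →
    Complex.I * dt T r x t - 1 / (Real.sqrt 3 : ℂ) * dx (dx r) x t
      + 2 * Complex.I * q x t * dx q x t = 0
  /-- decay as `x → ∞`, uniformly in `t`, with an integrable majorant -/
  decay : ∃ φ : ℝ → ℝ, MeasureTheory.IntegrableOn φ (Ioi 0) ∧
    Filter.Tendsto φ Filter.atTop (nhds 0) ∧
    ∀ x t, 0 ≤ x → t ∈ Icc 0 T →
      ‖q x t‖ ≤ φ x ∧ ‖r x t‖ ≤ φ x ∧ ‖dx q x t‖ ≤ φ x ∧ ‖dx r x t‖ ≤ φ x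

/-! ### The Lax pair -/

def V₁ (q r : ℝ → ℝ → ℂ) (x t : ℝ) : Mat :=
  !![0, q x t, r x t;
     r x t, 0, q x t;
     q x t, r x t, 0]

def V₂one (q r : ℝ → ℝ → ℂ) (x t : ℝ) : Mat :=
  !![0, ω * q x t, ω ^ 2 * r x t;
     ω * r x t, 0, q x t;
     ω ^ 2 * q x t, r x t, 0]

def V₂zero (q r : ℝ → ℝ → ℂ) (x t : ℝ) : Mat :=
  (Complex.I / (Real.sqrt 3 : ℂ)) •
    !![0, dx q x t, -dx r x t;
       -dx r x t, 0, dx q x t;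
       dx q x t, -dx r x t, 0]
  - !![0, r x t ^ 2, q x t ^ 2;
       q x t ^ 2, 0, r x t ^ 2;
       r x t ^ 2, q x t ^ 2, 0]

def V₂ (q r : ℝ → ℝ → ℂ) (k : ℂ) (x t : ℝ) : Mat :=
  k • V₂one q r x t + V₂zero q r x t

/-- The coefficients of a pair of equations
`μ_x - [diag ℓ, μ] = P₁ μ`, `μ_t - [diag ζ, μ] = P₂ μ`. -/
structure LaxPair where
  ℓ : Fin 3 → ℂ
  ζ : Fin 3 → ℂ
  P₁ : ℝ → ℝ → Mat
  P₂ : ℝ → ℝ → Mat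

/-- `μ_x - [𝓛, μ] = V₁ μ`, `μ_t - [𝓩, μ] = V₂ μ`. -/
def lax (q r : ℝ → ℝ → ℂ) (k : ℂ) : LaxPair :=
  ⟨l k, z k, V₁ q r, V₂ q r k⟩

/-- The pair satisfied by the cofactor matrices of the eigenfunctions:
`μ_x + [𝓛, μ] = -V₁ᵀ μ`, `μ_t + [𝓩, μ] = -V₂ᵀ μ`. -/
def cofactorLax (q r : ℝ → ℝ → ℂ) (k : ℂ) : LaxPair :=
  ⟨-l k, -z k, fun x t => -(V₁ q r x t).transpose, fun x t => -(V₂ q r k x t).transpose⟩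

/-- The three contours ending at `(x, t)`:
`γ₁` is `(0,T) → (0,t) → (x,t)`, `γ₂` is `(0,0) → (0,t) → (x,t)`, `γ₃` is `(∞,t) → (x,t)`. -/
inductive Contour
  | γ₁
  | γ₂
  | γ₃

/-- `∫_{(0,t₀) → (0,t) → (x,t)}` of the `i`-th component of
`e^{(ℓ_i - ℓ_j)(x - x') + (ζ_i - ζ_j)(t - t')} (P₁ dx' + P₂ dt') w`. -/
def integralFrom (P : LaxPair) (j : Fin 3) (w : ℝ → ℝ → Fin 3 → ℂ) (t₀ x t : ℝ)
    (i : Fin 3) : ℂ :=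
  (∫ t' in t₀..t, Complex.exp ((P.ℓ i - P.ℓ j) * (x : ℂ) + (P.ζ i - P.ζ j) * ((t : ℂ) - t')) *
      (P.P₂ 0 t').mulVec (w 0 t') i)
  + ∫ x' in (0 : ℝ)..x, Complex.exp ((P.ℓ i - P.ℓ j) * ((x : ℂ) - x')) *
      (P.P₁ x' t).mulVec (w x' t) i

/-- `∫_γ` of the `i`-th component of
`e^{(ℓ_i - ℓ_j)(x - x') + (ζ_i - ζ_j)(t - t')} (P₁ dx' + P₂ dt') w`. -/
def contourIntegral (P : LaxPair) (T : ℝ) (c : Contour) (j : Fin 3)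
    (w : ℝ → ℝ → Fin 3 → ℂ) (x t : ℝ) (i : Fin 3) : ℂ :=
  match c with
  | Contour.γ₁ => integralFrom P j w T x t i
  | Contour.γ₂ => integralFrom P j w 0 x t i
  | Contour.γ₃ => -∫ x' in Ioi x, Complex.exp ((P.ℓ i - P.ℓ j) * ((x : ℂ) - x')) *
      (P.P₁ x' t).mulVec (w x' t) i

/-- `w` is the `j`-th column of an eigenfunction `μ` of the pair `P` on `x ≥ 0`, `0 ≤ t ≤ T` such
that `μ_ij = δ_ij + ∫_{c i} (e^{ℓ^ (x - x') + ζ^ (t - t')} (P₁ dx' + P₂ dt') μ)_ij`. -/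
structure IsEigenColumn (P : LaxPair) (T : ℝ) (j : Fin 3) (c : Fin 3 → Contour)
    (w : ℝ → ℝ → Fin 3 → ℂ) : Prop where
  lax_x : ∀ x t, 0 ≤ x → t ∈ Icc 0 T → ∀ i,
    HasDerivWithinAt (fun y => w y t i)
      ((P.ℓ i - P.ℓ j) * w x t i + (P.P₁ x t).mulVec (w x t) i) (Ici 0) x
  lax_t : ∀ x t, 0 ≤ x → t ∈ Icc 0 T → ∀ i,
    HasDerivWithinAt (fun s => w x s i)
      ((P.ζ i - P.ζ j) * w x t i + (P.P₂ x t).mulVec (w x t) i) (Icc 0 T) t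
  integral_eq : ∀ x t, 0 ≤ x → t ∈ Icc 0 T → ∀ i,
    w x t i = (if i = j then 1 else 0) + contourIntegral P T (c i) j w x t i

/-- `w` is bounded on the closed domain. -/
def BoundedOn (T : ℝ) (w : ℝ → ℝ → Fin 3 → ℂ) : Prop :=
  ∃ C : ℝ, ∀ x t, 0 ≤ x → t ∈ Icc 0 T → ∀ i, ‖w x t i‖ ≤ C

/-! ### The domains -/

/-- `Re l_a < Re l_b < Re l_c` and `Re z_d < Re z_e < Re z_f`. -/
def orderSet (a b c d e f : Fin 3) : Set ℂ :=
  {k | (l k a).re < (l k b).re ∧ (l k b).re < (l k c).re ∧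
       (z k d).re < (z k e).re ∧ (z k e).re < (z k f).re}

/-- The open sets `D₁, …, D₁₂` (empty for the other indices). -/
def D : ℕ → Set ℂ
  | 1 => orderSet 2 1 0 0 2 1
  | 2 => orderSet 2 1 0 2 0 1
  | 3 => orderSet 2 0 1 2 1 0
  | 4 => orderSet 2 0 1 1 2 0
  | 5 => orderSet 0 2 1 1 0 2
  | 6 => orderSet 0 2 1 0 1 2
  | 7 => orderSet 0 1 2 0 2 1
  | 8 => orderSet 0 1 2 2 0 1
  | 9 => orderSet 1 0 2 2 1 0
  | 10 => orderSet 1 0 2 1 2 0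
  | 11 => orderSet 1 2 0 1 0 2
  | 12 => orderSet 1 2 0 0 1 2
  | _ => ∅

/-- `𝓢 = D₁ ∪ D₂ ∪ D₃ ∪ D₄`. -/
def sectorS : Set ℂ := D 1 ∪ D 2 ∪ D 3 ∪ D 4

/-- The `j`-th set of the triple `(ω𝓢, ω²𝓢, 𝓢)`. -/
def sectorCol (j : Fin 3) : Set ℂ := {k | ∃ κ ∈ sectorS, k = ω ^ ((j : ℕ) + 1) * κ}

/-- The `j`-th set of the triple of reflections `(ω𝓢^, ω²𝓢^, 𝓢^)`, where `𝓢^ = -𝓢`. -/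
def reflSectorCol (j : Fin 3) : Set ℂ := {k | -k ∈ sectorCol j}

/-! ### The eigenfunctions and the spectral functions -/

/-- `μ = μ₁(·,·,k)`. -/
def IsMu₁ (T : ℝ) (q r : ℝ → ℝ → ℂ) (k : ℂ) (μ : ℝ → ℝ → Mat) : Prop :=
  ∀ j, IsEigenColumn (lax q r k) T j (fun _ => Contour.γ₁) (fun x t i => μ x t i j)

/-- `w` is the `j`-th column of `μ₃(·,·,k)`. -/
def IsMu₃Col (T : ℝ) (q r : ℝ → ℝ → ℂ) (k : ℂ) (j : Fin 3) (w : ℝ → ℝ → Fin 3 → ℂ) : Prop :=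
  IsEigenColumn (lax q r k) T j (fun _ => Contour.γ₃) w ∧ BoundedOn T w

/-- `w` is the `j`-th column of the cofactor eigenfunction `μ₃^A(·,·,k)`. -/
def IsMu₃CofactorCol (T : ℝ) (q r : ℝ → ℝ → ℂ) (k : ℂ) (j : Fin 3)
    (w : ℝ → ℝ → Fin 3 → ℂ) : Prop :=
  IsEigenColumn (cofactorLax q r k) T j (fun _ => Contour.γ₃) w ∧ BoundedOn T w

open Classical in
/-- The contours `γ_ij^n`, for `k ∈ D_n`. -/
def contour (k : ℂ) (i j : Fin 3) : Contour :=
  if (l k i).re < (l k j).re then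
    if (z k i).re < (z k j).re then Contour.γ₂ else Contour.γ₁
  else Contour.γ₃

/-- For `k ∈ D_n`: `M` is a bounded solution of the system of integral equations
for `M_n(·,·,k)`. -/
def IsM (T : ℝ) (q r : ℝ → ℝ → ℂ) (k : ℂ) (M : ℝ → ℝ → Mat) : Prop :=
  ∀ j, IsEigenColumn (lax q r k) T j (fun i => contour k i j) (fun x t i => M x t i j) ∧
    BoundedOn T (fun x t i => M x t i j)

/-- `k` is not one of the singularities of `M`: the system of integral equations
has one and only one bounded solution. -/
def Regular (T : ℝ) (q r : ℝ → ℝ → ℂ) (k : ℂ) : Prop :=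
  (∃ M, IsM T q r k M) ∧
  ∀ M M', IsM T q r k M → IsM T q r k M' → ∀ x t, 0 ≤ x → t ∈ Icc 0 T → M x t = M' x t

/-- `S(k) = μ₁(0,0,k)` for `k ∈ ℂ`. -/
def IsSpectralS (T : ℝ) (q r : ℝ → ℝ → ℂ) (S : ℂ → Mat) : Prop :=
  ∀ k, ∃ μ, IsMu₁ T q r k μ ∧ S k = μ 0 0

/-- `s(k) = μ₃(0,0,k)` for `k ∈ (ω𝓢, ω²𝓢, 𝓢)`, column by column. -/
def IsSpectrals (T : ℝ) (q r : ℝ → ℝ → ℂ) (s : ℂ → Mat) : Prop :=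
  ∀ j, ∀ k ∈ sectorCol j, ∃ w, IsMu₃Col T q r k j w ∧ ∀ i, s k i j = w 0 0 i

/-- `s^A(k) = μ₃^A(0,0,k)` for `k ∈ (ω𝓢^, ω²𝓢^, 𝓢^)`, column by column. -/
def IsSpectralsA (T : ℝ) (q r : ℝ → ℝ → ℂ) (sA : ℂ → Mat) : Prop :=
  ∀ j, ∀ k ∈ reflSectorCol j, ∃ w, IsMu₃CofactorCol T q r k j w ∧ ∀ i, sA k i j = w 0 0 i

/-- `S_n(k) = M_n(0,0,k)` for `k ∈ D_n`, away from the singularities. -/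
def IsSpectralSn (T : ℝ) (q r : ℝ → ℝ → ℂ) (Sn : ℕ → ℂ → Mat) : Prop :=
  ∀ n, ∀ k ∈ D n, Regular T q r k → ∃ M, IsM T q r k M ∧ Sn n k = M 0 0

/-! ### Minors and the denominators -/

/-- The minor `m_ij(X)`: the determinant of `X` without its row `i` and its column `j`. -/
def minor (X : Mat) (i j : Fin 3) : ℂ := (X.submatrix i.succAbove j.succAbove).det

/-- The minors `m_ij(s) = (-1)^{i+j} (s^A)_ij`, read off from the cofactor matrix `s^A`. (The
columns of `s(k)` have disjoint domains, so that a minor of `s` at a point `k` is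
not computed from the entries of `s(k)`; it is given by the cofactor eigenfunction `μ₃^A`.) -/
def cofMinor (sA : Mat) (i j : Fin 3) : ℂ := (-1) ^ ((i : ℕ) + (j : ℕ)) * sA i j

def W₁ (S sA : Mat) : ℂ :=
  S 0 0 * cofMinor sA 0 0 - S 1 0 * cofMinor sA 1 0 + S 2 0 * cofMinor sA 2 0

def W₂ (S sA : Mat) : ℂ :=
  cofMinor sA 0 0 * minor S 1 1 - cofMinor sA 1 0 * minor S 0 1

def W₃ (S sA : Mat) : ℂ :=
  cofMinor sA 1 1 * minor S 0 0 - cofMinor sA 0 1 * minor S 1 0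

def W₄ (S sA : Mat) : ℂ :=
  -(S 0 1 * cofMinor sA 0 1) + S 1 1 * cofMinor sA 1 1 - S 2 1 * cofMinor sA 2 1

/-- `n + 4`, with the indices `1, …, 12` modulo `12`. -/
def shift (n : ℕ) : ℕ := if n ≤ 8 then n + 4 else n - 8

end Lax3

end

open Lax3

noncomputable section

namespace Lax3

open Set Filter Topology MeasureTheory

/-! All eigenfunctions solve the same linear system, so a column of one expands in the columns of
another with coefficients that are constants times explicit exponentials. The formulas come from
evaluating such constants at infinity along `t = 0` and at `t = T` along `x = 0`.

Let `M` solve the problem for `M_n`. Entries on `γ₃` are `δ_ij` plus a tail integral, and the others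
carry a decaying exponential; hence `M → I` as `x → ∞`, and `det M = 1` because the coefficients are
trace free. In `D₁, …, D₄`, `Re l₃` is the least, so the comparison at infinity identifies the third
column of `M(0,0)` with that of `s` (`IsM.eq_mu₃Col`). For the index `a` with `Re l_a` greatest,
pairing with the cofactor solution identifies column `a` of `s^A` with row `a` of `M(0,0)⁻¹`
(`IsM.pairing_cofactorCol`). Since `μ₁(0,T) = I`, a coefficient of a column of `M(0,0)` in the
columns of `S` vanishes exactly when the corresponding entry of `M(0,T)` does
(`IsMu₁.cramer_eq_zero_iff`). Entries on `γ₁` vanish at `(0,T)`, those on `γ₂` at `(0,0)`. These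
linear relations determine `M(0,0)`.

Some denominators are nonzero because `det M = 1` or because a pairing equals 1. For the others
uniqueness is needed: if one vanished, an exponential multiple of one column of `M` could be added
to another without violating any normalization, giving a second bounded solution
(`Regular.not_addColumn`).

The symmetry is a relabelling: `k ↦ ωk` shifts the indices of `l`, `z`, `V₁`, `V₂` cyclically, and
conjugation by `A` is that shift on matrices. -/

/-! ### Conserved quantities of the linear systems -/

theorem eqOn_of_hasDerivWithinAt_zero {s : Set ℝ} (hs : Convex ℝ s) {f : ℝ → ℂ}
    (hf : ∀ x ∈ s, HasDerivWithinAt f 0 s x) {x y : ℝ} (hx : x ∈ s) (hy : y ∈ s) :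
    f x = f y := by
  have := hs.norm_image_sub_le_of_norm_hasDerivWithin_le (f := f) (f' := fun _ => 0) (C := 0)
    hf (by simp) hx hy
  simp only [zero_mul, norm_le_zero_iff, sub_eq_zero] at this
  exact this.symm

theorem mul_exp_const {s : Set ℝ} (hs : Convex ℝ s) {f : ℝ → ℂ} {c : ℂ}
    (hf : ∀ x ∈ s, HasDerivWithinAt f (-c * f x) s x) {x y : ℝ} (hx : x ∈ s) (hy : y ∈ s) :
    f x * Complex.exp (c * x) = f y * Complex.exp (c * y) := by
  refine eqOn_of_hasDerivWithinAt_zero hs (f := fun x : ℝ => f x * Complex.exp (c * x)) ?_ hx hy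
  intro u hu
  have h1 : HasDerivWithinAt (fun x : ℝ => Complex.exp (c * x)) (Complex.exp (c * u) * (c * 1)) s u :=
    ((Complex.ofRealCLM.hasDerivAt.const_mul c).cexp).hasDerivWithinAt
  refine ((hf u hu).mul h1).congr_deriv ?_
  ring

/-- The columns of `X` solve `X' = diag(lam) X - X diag(a) + B X` on `s`. -/
def SolvesColumns (s : Set ℝ) (lam : Fin 3 → ℂ) (B : ℝ → Mat) (a : Fin 3 → ℂ) (X : ℝ → Mat) : Prop :=
  ∀ j, ∀ x ∈ s, ∀ i, HasDerivWithinAt (fun y => X y i j)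
    ((lam i - a j) * X x i j + (B x).mulVec (fun i => X x i j) i) s x

/-- Liouville's formula: the logarithmic derivative of the determinant is `∑ lam - ∑ a + tr B`, of
which only `-∑ a` survives. -/
theorem SolvesColumns.det_const {s : Set ℝ} (hs : Convex ℝ s) {lam a : Fin 3 → ℂ} {B : ℝ → Mat}
    {X : ℝ → Mat} (h : SolvesColumns s lam B a X) (hlam : ∑ i, lam i = 0)
    (hB : ∀ x ∈ s, (B x).trace = 0) {x y : ℝ} (hx : x ∈ s) (hy : y ∈ s) :
    (X x).det * Complex.exp ((∑ j, a j) * x) = (X y).det * Complex.exp ((∑ j, a j) * y) := by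
  refine mul_exp_const hs (f := fun x => (X x).det) ?_ hx hy
  intro u hu
  have e := fun i j => h j u hu i
  have hB := hB u hu
  simp only [Matrix.mulVec, dotProduct, Fin.sum_univ_three, Matrix.trace, Matrix.diag] at e hB hlam ⊢
  simp only [Matrix.det_fin_three]
  refine (((((((e 0 0).mul (e 1 1)).mul (e 2 2)).sub (((e 0 0).mul (e 1 2)).mul (e 2 1))).sub
    (((e 0 1).mul (e 1 0)).mul (e 2 2))).add (((e 0 1).mul (e 1 2)).mul (e 2 0))).add
    (((e 0 2).mul (e 1 0)).mul (e 2 1))).sub (((e 0 2).mul (e 1 1)).mul (e 2 0)) |>.congr_deriv ?_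
  simp only [Pi.mul_apply]
  linear_combination (X u).det * (hlam + hB) +
    (-lam 0 - lam 1 - lam 2 - B u 0 0 - B u 1 1 - B u 2 2) * (Matrix.det_fin_three (X u))

/-- The systems of `u` and `w` are adjoint, so `lam` and `B` cancel in the derivative of the
pairing, leaving the factor `b - a`. -/
theorem pairing_const {s : Set ℝ} (hs : Convex ℝ s) {lam : Fin 3 → ℂ} {B : ℝ → Mat} {a b : ℂ}
    {u w : ℝ → Fin 3 → ℂ}
    (hu : ∀ x ∈ s, ∀ i, HasDerivWithinAt (fun y => u y i)
      ((-lam i + b) * u x i + (-(B x).transpose).mulVec (u x) i) s x)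
    (hw : ∀ x ∈ s, ∀ i, HasDerivWithinAt (fun y => w y i)
      ((lam i - a) * w x i + (B x).mulVec (w x) i) s x) {x y : ℝ} (hx : x ∈ s) (hy : y ∈ s) :
    (u x ⬝ᵥ w x) * Complex.exp ((a - b) * x) = (u y ⬝ᵥ w y) * Complex.exp ((a - b) * y) := by
  refine mul_exp_const hs (f := fun x => u x ⬝ᵥ w x) ?_ hx hy
  intro v hv
  have hu := hu v hv
  have hw := hw v hv
  simp only [Matrix.mulVec, dotProduct, Fin.sum_univ_three, Matrix.neg_apply,
    Matrix.transpose_apply] at hu hw ⊢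
  refine ((((hu 0).mul (hw 0)).add ((hu 1).mul (hw 1))).add ((hu 2).mul (hw 2))).congr_deriv ?_
  ring

/-! ### Exponential integrals at infinity and variation of constants -/

theorem norm_exp_mul_le_one {a : ℂ} (ha : 0 ≤ a.re) {x y : ℝ} (h : x ≤ y) :
    ‖Complex.exp (a * ((x : ℂ) - y))‖ ≤ 1 := by
  rw [Complex.norm_exp, ← Complex.ofReal_sub, Complex.re_mul_ofReal]
  exact Real.exp_le_one_iff.2 (mul_nonpos_of_nonneg_of_nonpos ha (by linarith))

theorem tendsto_integral_Ioi_zero {ψ : ℝ → ℝ} (hψ : IntegrableOn ψ (Ioi 0)) :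
    Tendsto (fun x => ∫ y in Ioi x, ψ y) atTop (𝓝 0) := by
  have h := (tendsto_const_nhds (x := ∫ y in Ioi (0 : ℝ), ψ y)).sub
    (intervalIntegral_tendsto_integral_Ioi 0 hψ tendsto_id)
  rw [sub_self] at h
  refine h.congr' ?_
  filter_upwards [eventually_ge_atTop 0] with x hx
  have hint : IntegrableOn ψ (Ioi x) := hψ.mono_set (Ioi_subset_Ioi hx)
  rw [sub_eq_iff_eq_add, add_comm]
  simpa using (intervalIntegral.integral_interval_add_Ioi hψ hint).symm

theorem tendsto_tail_integral {a : ℂ} (ha : 0 ≤ a.re) {f : ℝ → ℂ} {ψ : ℝ → ℝ}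
    (hψ : IntegrableOn ψ (Ioi 0)) (hf : ∀ x, 0 ≤ x → ‖f x‖ ≤ ψ x) :
    Tendsto (fun x : ℝ => ∫ y in Ioi x, Complex.exp (a * ((x : ℂ) - y)) * f y) atTop (𝓝 0) := by
  refine squeeze_zero_norm' ?_ (tendsto_integral_Ioi_zero hψ)
  filter_upwards [eventually_ge_atTop 0] with x hx
  refine norm_integral_le_of_norm_le (hψ.mono_set (Ioi_subset_Ioi hx)) ?_
  filter_upwards [ae_restrict_mem measurableSet_Ioi] with y hy
  rw [norm_mul]
  have h0 := hf y (hx.trans (le_of_lt hy))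
  calc _ ≤ 1 * ‖f y‖ := by gcongr; exact norm_exp_mul_le_one ha (le_of_lt hy)
    _ ≤ _ := by linarith

/-- Dominated convergence: for `y ≤ x` the kernel is at most 1, and for fixed `y` it tends to 0
because the sign of `a.re` is strict. -/
theorem tendsto_damped_integral {a : ℂ} (ha : a.re < 0) {f : ℝ → ℂ} {ψ : ℝ → ℝ}
    (hψ : IntegrableOn ψ (Ioi 0)) (hf : ∀ x, 0 ≤ x → ‖f x‖ ≤ ψ x) :
    Tendsto (fun x : ℝ => ∫ y in (0 : ℝ)..x, Complex.exp (a * ((x : ℂ) - y)) * f y)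
      atTop (𝓝 0) := by
  have key : Tendsto (fun x : ℝ => ∫ y in Ioi (0 : ℝ),
      (Iic x).indicator (fun y => Real.exp (a.re * (x - y)) * ψ y) y) atTop
      (𝓝 (∫ y in Ioi (0 : ℝ), (0 : ℝ))) := by
    refine tendsto_integral_filter_of_dominated_convergence ψ ?_ ?_ hψ ?_
    · refine Eventually.of_forall fun x => ?_
      refine AEStronglyMeasurable.indicator ?_ measurableSet_Iic
      exact (Continuous.aestronglyMeasurable (by fun_prop)).mul hψ.aestronglyMeasurable
    · refine Eventually.of_forall fun x => ?_
      filter_upwards [ae_restrict_mem measurableSet_Ioi] with y hy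
      have h0 : 0 ≤ ψ y := (norm_nonneg _).trans (hf y (le_of_lt hy))
      by_cases h : y ∈ Iic x
      · rw [indicator_of_mem h, norm_mul, Real.norm_of_nonneg h0,
          Real.norm_of_nonneg (Real.exp_nonneg _)]
        have : Real.exp (a.re * (x - y)) ≤ 1 := by
          refine Real.exp_le_one_iff.2 (mul_nonpos_of_nonpos_of_nonneg ha.le ?_)
          simpa using h
        nlinarith
      · rw [indicator_of_notMem h]; simpa using h0
    · refine Eventually.of_forall fun y => ?_
      have h1 : Tendsto (fun x : ℝ => Real.exp (a.re * (x - y)) * ψ y) atTop (𝓝 (0 * ψ y)) := by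
        refine Tendsto.mul_const _ (Real.tendsto_exp_atBot.comp ?_)
        exact (tendsto_atTop_add_const_right _ _ tendsto_id).const_mul_atTop_of_neg ha
      rw [zero_mul] at h1
      refine h1.congr' ?_
      filter_upwards [eventually_ge_atTop y] with x hx
      rw [indicator_of_mem (by simpa using hx)]
  rw [integral_zero] at key
  refine squeeze_zero_norm' ?_ key
  filter_upwards [eventually_ge_atTop 0] with x hx
  rw [intervalIntegral.integral_of_le hx, setIntegral_indicator measurableSet_Iic, Ioi_inter_Iic]
  have hint : IntegrableOn ψ (Ioc 0 x) := hψ.mono_set Ioc_subset_Ioi_self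
  refine norm_integral_le_of_norm_le ?_ ?_
  · refine Integrable.bdd_mul (c := 1) hint
      (Continuous.aestronglyMeasurable (by fun_prop)) ?_
    filter_upwards [ae_restrict_mem measurableSet_Ioc] with y hy
    rw [Real.norm_of_nonneg (Real.exp_nonneg _)]
    exact Real.exp_le_one_iff.2 (mul_nonpos_of_nonpos_of_nonneg ha.le (by linarith [hy.2]))
  · filter_upwards [ae_restrict_mem measurableSet_Ioc] with y hy
    rw [norm_mul, Complex.norm_exp, ← Complex.ofReal_sub, Complex.re_mul_ofReal]
    have := hf y (le_of_lt hy.1)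
    gcongr

theorem hasDerivWithinAt_exp_mul {s : Set ℝ} {f : ℝ → ℂ} {a g : ℂ} {x y : ℝ}
    (hf : HasDerivWithinAt f (a * f y + g) s y) :
    HasDerivWithinAt (fun y : ℝ => Complex.exp (a * ((x : ℂ) - y)) * f y)
      (Complex.exp (a * ((x : ℂ) - y)) * g) s y := by
  have h1 : HasDerivWithinAt (fun y : ℝ => Complex.exp (a * ((x : ℂ) - y)))
      (Complex.exp (a * ((x : ℂ) - y)) * (a * -1)) s y :=
    (((Complex.ofRealCLM.hasDerivAt.const_sub (x : ℂ)).const_mul a).cexp).hasDerivWithinAt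
  refine (h1.mul hf).congr_deriv ?_
  ring

/-- Integrate the derivative of `e^{a(x-y)} f(y)` over `(x, ∞)`. The condition `a * δ = 0` makes the
boundary term at infinity equal to `δ`: either the exponential is 1, or it is bounded and `f → 0`.
It holds for `a = ℓ_i - ℓ_j` and `δ = δ_ij`. -/
theorem eq_sub_integral_Ioi {a δ : ℂ} (ha : 0 ≤ a.re) (haδ : a * δ = 0) {f g : ℝ → ℂ} {ψ : ℝ → ℝ}
    (hf : ∀ x, 0 ≤ x → HasDerivWithinAt f (a * f x + g x) (Ici 0) x)
    (hg : ContinuousOn g (Ici 0)) (hψ : IntegrableOn ψ (Ioi 0))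
    (hgψ : ∀ x, 0 ≤ x → ‖g x‖ ≤ ψ x) (hlim : Tendsto f atTop (𝓝 δ)) {x : ℝ} (hx : 0 ≤ x) :
    f x = δ + -∫ y in Ioi x, Complex.exp (a * ((x : ℂ) - y)) * g y := by
  have hbd : ∀ y ∈ Ioi x, ‖Complex.exp (a * ((x : ℂ) - y))‖ ≤ 1 := fun y hy =>
    norm_exp_mul_le_one ha (le_of_lt hy)
  have h := integral_Ioi_of_hasDerivAt_of_tendsto (a := x) (m := δ)
    (f := fun y : ℝ => Complex.exp (a * ((x : ℂ) - y)) * f y)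
    (f' := fun y : ℝ => Complex.exp (a * ((x : ℂ) - y)) * g y) ?_ ?_ ?_ ?_
  · rw [h]; simp
  · exact ((hasDerivWithinAt_exp_mul (hf x hx)).continuousWithinAt).mono (Ici_subset_Ici.2 hx)
  · intro y hy
    have hy0 : 0 < y := hx.trans_lt hy
    exact (hasDerivWithinAt_exp_mul (hf y hy0.le)).hasDerivAt (Ici_mem_nhds hy0)
  · have hsub : Ioi x ⊆ Ici (0 : ℝ) := fun y hy => hx.trans (le_of_lt hy)
    have hgi : IntegrableOn g (Ioi x) := by
      refine Integrable.mono' (hψ.mono_set (Ioi_subset_Ioi hx))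
        ((hg.mono hsub).aestronglyMeasurable measurableSet_Ioi) ?_
      filter_upwards [ae_restrict_mem measurableSet_Ioi] with y hy using hgψ y (hsub hy)
    refine Integrable.bdd_mul (c := 1) hgi (Continuous.aestronglyMeasurable (by fun_prop)) ?_
    filter_upwards [ae_restrict_mem measurableSet_Ioi] with y hy using hbd y hy
  · rcases mul_eq_zero.1 haδ with h0 | h0
    · simpa [h0] using hlim
    · subst h0
      refine squeeze_zero_norm' ?_ (tendsto_zero_iff_norm_tendsto_zero.1 hlim)
      filter_upwards [eventually_gt_atTop x] with y hy
      rw [norm_mul]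
      exact mul_le_of_le_one_left (norm_nonneg _) (hbd y hy)

theorem eq_exp_mul_add_integral {s : Set ℝ} (hs : s.OrdConnected) {a : ℂ} {f g : ℝ → ℂ}
    (hf : ∀ x ∈ s, HasDerivWithinAt f (a * f x + g x) s x) (hg : ContinuousOn g s)
    {x₀ x : ℝ} (hx₀ : x₀ ∈ s) (hx : x ∈ s) :
    f x = Complex.exp (a * ((x : ℂ) - x₀)) * f x₀
      + ∫ y in x₀..x, Complex.exp (a * ((x : ℂ) - y)) * g y := by
  have hsub : uIcc x₀ x ⊆ s := hs.uIcc_subset hx₀ hx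
  have h := intervalIntegral.integral_eq_sub_of_hasDeriv_right (a := x₀) (b := x)
    (f := fun y : ℝ => Complex.exp (a * ((x : ℂ) - y)) * f y)
    (f' := fun y : ℝ => Complex.exp (a * ((x : ℂ) - y)) * g y) ?_ ?_ ?_
  · rw [h]; simp
  · intro y hy
    exact ((hasDerivWithinAt_exp_mul (hf y (hsub hy))).continuousWithinAt).mono hsub
  · intro y hy
    have hm : uIcc x₀ x ∈ 𝓝 y := Icc_mem_nhds hy.1 hy.2
    exact ((hasDerivWithinAt_exp_mul (hf y (hsub (Ioo_subset_Icc_self hy)))).hasDerivAt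
      (mem_of_superset hm hsub)).hasDerivWithinAt
  · exact (ContinuousOn.mul (by fun_prop) (hg.mono hsub)).intervalIntegrable

/-- The entries of `P₁` have a common integrable majorant on the half-line. -/
def LaxPair.Decays (P : LaxPair) (T : ℝ) : Prop :=
  ∃ φ : ℝ → ℝ, IntegrableOn φ (Ioi 0) ∧
    ∀ x t, 0 ≤ x → t ∈ Icc 0 T → ∀ i j, ‖P.P₁ x t i j‖ ≤ φ x

/-! ### Integral equations versus normalizations -/

theorem norm_mulVec_le {B : Mat} {v : Fin 3 → ℂ} {b C : ℝ} (hB : ∀ i j, ‖B i j‖ ≤ b)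
    (hv : ∀ i, ‖v i‖ ≤ C) (i : Fin 3) : ‖B.mulVec v i‖ ≤ 3 * C * b := by
  have hb : 0 ≤ b := (norm_nonneg _).trans (hB 0 0)
  calc ‖∑ j, B i j * v j‖ ≤ ∑ j : Fin 3, ‖B i j * v j‖ := norm_sum_le _ _
    _ ≤ ∑ _j : Fin 3, b * C := by
        refine Finset.sum_le_sum fun j _ => ?_
        rw [norm_mul]
        exact mul_le_mul (hB i j) (hv j) (norm_nonneg _) hb
    _ = _ := by simp; ring

theorem LaxPair.Decays.exists_majorant {P : LaxPair} {T : ℝ} (hP : P.Decays T)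
    {w : ℝ → ℝ → Fin 3 → ℂ} (hw : BoundedOn T w) :
    ∃ ψ : ℝ → ℝ, IntegrableOn ψ (Ioi 0) ∧
      ∀ x t, 0 ≤ x → t ∈ Icc 0 T → ∀ i, ‖(P.P₁ x t).mulVec (w x t) i‖ ≤ ψ x := by
  obtain ⟨φ, hφ, hb⟩ := hP
  obtain ⟨C, hC⟩ := hw
  exact ⟨fun x => 3 * C * φ x, hφ.const_mul _, fun x t hx ht i =>
    norm_mulVec_le (hb x t hx ht) (hC x t hx ht) i⟩

theorem integralFrom_eq (P : LaxPair) (j : Fin 3) (w : ℝ → ℝ → Fin 3 → ℂ) (t₀ x t : ℝ)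
    (i : Fin 3) :
    integralFrom P j w t₀ x t i =
      Complex.exp ((P.ℓ i - P.ℓ j) * x) *
        (∫ t' in t₀..t, Complex.exp ((P.ζ i - P.ζ j) * ((t : ℂ) - t')) *
          (P.P₂ 0 t').mulVec (w 0 t') i)
      + ∫ x' in (0 : ℝ)..x, Complex.exp ((P.ℓ i - P.ℓ j) * ((x : ℂ) - x')) *
        (P.P₁ x' t).mulVec (w x' t) i := by
  rw [integralFrom, ← intervalIntegral.integral_const_mul]
  simp only [Complex.exp_add, mul_assoc]

theorem tendsto_exp_mul_atTop {a : ℂ} (ha : a.re < 0) :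
    Tendsto (fun x : ℝ => Complex.exp (a * x)) atTop (𝓝 0) := by
  rw [tendsto_zero_iff_norm_tendsto_zero]
  simp only [Complex.norm_exp, Complex.re_mul_ofReal]
  exact Real.tendsto_exp_atBot.comp (tendsto_id.const_mul_atTop_of_neg ha)

/-- The contours are compatible with the growth of the exponentials in the `j`-th column. -/
def ContoursFit (P : LaxPair) (j : Fin 3) (c : Fin 3 → Contour) : Prop :=
  ∀ i, (c i = Contour.γ₃ ∧ 0 ≤ (P.ℓ i - P.ℓ j).re) ∨
    (c i ≠ Contour.γ₃ ∧ i ≠ j ∧ (P.ℓ i - P.ℓ j).re < 0)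

/-- On `γ₃` the integral is the tail of an integrable function. On `γ₁` and `γ₂` the inequality `Re
ℓ_i < Re ℓ_j` damps both the boundary contribution from `x = 0` and the integral in `x`. -/
theorem IsEigenColumn.tendsto_atTop {P : LaxPair} {T : ℝ} (hP : P.Decays T) {j : Fin 3}
    {c : Fin 3 → Contour} {w : ℝ → ℝ → Fin 3 → ℂ} (h : IsEigenColumn P T j c w)
    (hb : BoundedOn T w) (hc : ContoursFit P j c) {t : ℝ} (ht : t ∈ Icc 0 T) (i : Fin 3) :
    Tendsto (fun x => w x t i) atTop (𝓝 (if i = j then 1 else 0)) := by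
  obtain ⟨ψ, hψ, hf⟩ := hP.exists_majorant hb
  suffices H : Tendsto (fun x => contourIntegral P T (c i) j w x t i) atTop (𝓝 0) by
    have := H.const_add (if i = j then (1 : ℂ) else 0)
    rw [add_zero] at this
    refine this.congr' ?_
    filter_upwards [eventually_ge_atTop 0] with x hx using (h.integral_eq x t hx ht i).symm
  have key : (P.ℓ i - P.ℓ j).re < 0 → ∀ t₀,
      Tendsto (fun x => integralFrom P j w t₀ x t i) atTop (𝓝 0) := by
    intro ha t₀
    simp only [integralFrom_eq]
    simpa using ((tendsto_exp_mul_atTop ha).mul_const _).add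
      (tendsto_damped_integral ha hψ fun x hx => hf x t hx ht i)
  rcases hc i with ⟨h3, ha⟩ | ⟨h3, -, ha⟩
  · simp only [h3, contourIntegral]
    simpa using (tendsto_tail_integral ha hψ fun x hx => hf x t hx ht i).neg
  · match hci : c i with
    | .γ₁ => exact key ha _
    | .γ₂ => exact key ha _
    | .γ₃ => exact absurd hci h3

theorem continuousOn_mulVec {s : Set ℝ} {B : ℝ → Mat} {v : ℝ → Fin 3 → ℂ}
    (hB : ∀ i j, ContinuousOn (fun x => B x i j) s) (hv : ∀ i, ContinuousOn (fun x => v x i) s)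
    (i : Fin 3) : ContinuousOn (fun x => (B x).mulVec (v x) i) s := by
  simp only [Matrix.mulVec, dotProduct]
  exact continuousOn_finsetSum _ fun j _ => (hB i j).mul (hv j)

/-- The normalization of the `i`-th entry of the `j`-th column which goes with a contour. -/
def Normalized (T : ℝ) (c : Contour) (i j : Fin 3) (w : ℝ → ℝ → Fin 3 → ℂ) : Prop :=
  match c with
  | Contour.γ₁ => w 0 T i = 0
  | Contour.γ₂ => w 0 0 i = 0
  | Contour.γ₃ => ∀ t ∈ Icc 0 T, Tendsto (fun x => w x t i) atTop (𝓝 (if i = j then 1 else 0))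

/-- Variation of constants turns the differential equations into the integral equations once the
value at the start of each contour is known. This lets modified solutions be recognized without
touching integrals. -/
theorem isEigenColumn_of_normalized {P : LaxPair} {T : ℝ} (hT : 0 < T) (hP : P.Decays T)
    (h₁ : ∀ t ∈ Icc 0 T, ∀ i j, ContinuousOn (fun x => P.P₁ x t i j) (Ici 0))
    (h₂ : ∀ i j, ContinuousOn (fun t => P.P₂ 0 t i j) (Icc 0 T))
    {j : Fin 3} {c : Fin 3 → Contour} {w : ℝ → ℝ → Fin 3 → ℂ}
    (hx : ∀ x t, 0 ≤ x → t ∈ Icc 0 T → ∀ i, HasDerivWithinAt (fun y => w y t i)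
      ((P.ℓ i - P.ℓ j) * w x t i + (P.P₁ x t).mulVec (w x t) i) (Ici 0) x)
    (ht : ∀ x t, 0 ≤ x → t ∈ Icc 0 T → ∀ i, HasDerivWithinAt (fun s => w x s i)
      ((P.ζ i - P.ζ j) * w x t i + (P.P₂ x t).mulVec (w x t) i) (Icc 0 T) t)
    (hb : BoundedOn T w) (hc : ContoursFit P j c) (hn : ∀ i, Normalized T (c i) i j w) :
    IsEigenColumn P T j c w := by
  refine ⟨hx, ht, fun x t hx0 ht0 i => ?_⟩
  obtain ⟨ψ, hψ, hf⟩ := hP.exists_majorant hb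
  have hg : ContinuousOn (fun x => (P.P₁ x t).mulVec (w x t) i) (Ici 0) :=
    continuousOn_mulVec (h₁ t ht0) (fun i y hy => (hx y t hy ht0 i).continuousWithinAt) i
  have hg2 : ContinuousOn (fun t => (P.P₂ 0 t).mulVec (w 0 t) i) (Icc 0 T) :=
    continuousOn_mulVec h₂ (fun i y hy => (ht 0 y le_rfl hy i).continuousWithinAt) i
  have key : i ≠ j → ∀ t₀ ∈ Icc 0 T, w 0 t₀ i = 0 → w x t i = integralFrom P j w t₀ x t i := by
    intro _ t₀ ht₀ hw
    have e1 := eq_exp_mul_add_integral ordConnected_Ici (fun y hy => hx y t hy ht0 i) hg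
      (self_mem_Ici) hx0
    have e2 := eq_exp_mul_add_integral ordConnected_Icc (fun y hy => ht 0 y le_rfl hy i) hg2
      ht₀ ht0
    rw [e1, e2, hw, integralFrom_eq]
    simp
  have hni := hn i
  rcases hc i with ⟨h3, ha⟩ | ⟨h3, hij, ha⟩
  · rw [h3] at hni ⊢
    refine eq_sub_integral_Ioi ha ?_ (fun y hy => hx y t hy ht0 i) hg hψ
      (fun y hy => hf y t hy ht0 i) (hni t ht0) hx0
    split_ifs with hij <;> simp [hij]
  · rw [if_neg hij, zero_add]
    match hci : c i with
    | .γ₁ => rw [hci] at hni; exact key hij _ (right_mem_Icc.2 hT.le) hni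
    | .γ₂ => rw [hci] at hni; exact key hij _ (left_mem_Icc.2 hT.le) hni
    | .γ₃ => exact absurd hci h3

/-! ### The coefficients of the Lax pair -/

theorem omega_pow_three : ω ^ 3 = 1 := by
  rw [ω, ← Complex.exp_nat_mul]
  convert Complex.exp_two_pi_mul_I using 2
  push_cast; ring

theorem omega_ne_zero : ω ≠ 0 := Complex.exp_ne_zero _

theorem one_add_omega_add_sq : 1 + ω + ω ^ 2 = 0 := by
  have h := Complex.isPrimitiveRoot_exp 3 (by norm_num)
  have := h.geom_sum_eq_zero (by norm_num)
  rw [Finset.sum_range_succ, Finset.sum_range_succ, Finset.sum_range_one] at this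
  have e : ω = Complex.exp (2 * Real.pi * Complex.I / (3 : ℕ)) := by rw [ω]; norm_num
  rw [e]; simpa using this

theorem sum_l (k : ℂ) : ∑ i, l k i = 0 := by
  simp [Fin.sum_univ_three, l, Jdiag]
  linear_combination k * one_add_omega_add_sq

theorem sum_z (k : ℂ) : ∑ i, z k i = 0 := by
  simp [Fin.sum_univ_three, z, Jdiag]
  linear_combination -k ^ 2 * one_add_omega_add_sq - k ^ 2 * ω * omega_pow_three

theorem trace_V₁ (q r : ℝ → ℝ → ℂ) (x t : ℝ) : (V₁ q r x t).trace = 0 := by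
  simp [V₁, Matrix.trace, Fin.sum_univ_three]

theorem trace_V₂ (q r : ℝ → ℝ → ℂ) (k : ℂ) (x t : ℝ) : (V₂ q r k x t).trace = 0 := by
  simp [V₂, V₂one, V₂zero, Matrix.trace, Fin.sum_univ_three]

theorem norm_V₁_le {q r : ℝ → ℝ → ℂ} {x t b : ℝ} (hq : ‖q x t‖ ≤ b) (hr : ‖r x t‖ ≤ b)
    (i j : Fin 3) : ‖V₁ q r x t i j‖ ≤ b := by
  have : 0 ≤ b := (norm_nonneg _).trans hq
  fin_cases i <;> fin_cases j <;> simpa [V₁]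

theorem IsSolution.decays {T : ℝ} {q r : ℝ → ℝ → ℂ} (h : IsSolution T q r) (k : ℂ) :
    (lax q r k).Decays T := by
  obtain ⟨φ, hφ, -, hb⟩ := h.decay
  exact ⟨φ, hφ, fun x t hx ht i j => norm_V₁_le (hb x t hx ht).1 (hb x t hx ht).2.1 i j⟩

theorem IsSolution.cofactor_decays {T : ℝ} {q r : ℝ → ℝ → ℂ} (h : IsSolution T q r) (k : ℂ) :
    (cofactorLax q r k).Decays T := by
  obtain ⟨φ, hφ, -, hb⟩ := h.decay
  refine ⟨φ, hφ, fun x t hx ht i j => ?_⟩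
  simpa [cofactorLax] using norm_V₁_le (hb x t hx ht).1 (hb x t hx ht).2.1 j i

theorem continuousOn_V₁ {T : ℝ} {q r : ℝ → ℝ → ℂ} (h : IsSolution T q r) {t : ℝ}
    (ht : t ∈ Icc 0 T) (i j : Fin 3) : ContinuousOn (fun x => V₁ q r x t i j) (Ici 0) := by
  have key : ∀ f : ℝ → ℝ → ℂ, ContDiffOn ℝ 2 (fun p : ℝ × ℝ => f p.1 p.2) (Ici 0 ×ˢ Icc 0 T) →
      ContinuousOn (fun x => f x t) (Ici 0) := fun f hf =>
    hf.continuousOn.comp (f := fun x : ℝ => (x, t)) (by fun_prop) fun x hx => ⟨hx, ht⟩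
  have hq := key q h.smooth_q
  have hr := key r h.smooth_r
  fin_cases i <;> fin_cases j <;> simp [V₁] <;> first | exact hq | exact hr | exact continuousOn_const

/-- At the boundary `dx f` is the derivative within the closed domain applied to `(1, 0)`, and that
derivative is continuous up to the boundary. -/
theorem continuousOn_dx_zero {T : ℝ} (hT : 0 < T) {f : ℝ → ℝ → ℂ}
    (hf : ContDiffOn ℝ 2 (fun p : ℝ × ℝ => f p.1 p.2) (Ici 0 ×ˢ Icc 0 T)) :
    ContinuousOn (fun t => dx f 0 t) (Icc 0 T) := by
  have hu : UniqueDiffOn ℝ (Ici (0 : ℝ) ×ˢ Icc 0 T) :=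
    (uniqueDiffOn_Ici 0).prod (uniqueDiffOn_Icc hT)
  have hc := hf.continuousOn_fderivWithin hu (by norm_num)
  have hc0 : ContinuousOn (fun t : ℝ => fderivWithin ℝ (fun p : ℝ × ℝ => f p.1 p.2)
      (Ici 0 ×ˢ Icc 0 T) (0, t) (1, 0)) (Icc 0 T) :=
    (hc.comp (f := fun t : ℝ => ((0 : ℝ), t)) (by fun_prop)
      fun t ht => ⟨self_mem_Ici, ht⟩).clm_apply continuousOn_const
  refine hc0.congr fun t ht => ?_
  have hd := (hf.differentiableOn (by norm_num) (0, t) ⟨self_mem_Ici, ht⟩).hasFDerivWithinAt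
  have hp : HasDerivWithinAt (fun y : ℝ => (y, t)) (1, 0) (Ici 0) 0 :=
    (hasDerivWithinAt_id _ _).prodMk (hasDerivWithinAt_const _ _ _)
  have := hd.comp_hasDerivWithinAt (f := fun y : ℝ => (y, t)) (0 : ℝ) hp fun y hy => ⟨hy, ht⟩
  exact this.derivWithin (uniqueDiffOn_Ici 0 0 self_mem_Ici)

theorem continuousOn_V₂ {T : ℝ} (hT : 0 < T) {q r : ℝ → ℝ → ℂ} (h : IsSolution T q r) (k : ℂ)
    (i j : Fin 3) : ContinuousOn (fun t => V₂ q r k 0 t i j) (Icc 0 T) := by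
  have key : ∀ f : ℝ → ℝ → ℂ, ContDiffOn ℝ 2 (fun p : ℝ × ℝ => f p.1 p.2) (Ici 0 ×ˢ Icc 0 T) →
      ContinuousOn (fun t => f 0 t) (Icc 0 T) := fun f hf =>
    hf.continuousOn.comp (f := fun t : ℝ => ((0 : ℝ), t)) (by fun_prop)
      fun x hx => ⟨self_mem_Ici, hx⟩
  have hq := key q h.smooth_q
  have hr := key r h.smooth_r
  have hq' := continuousOn_dx_zero hT h.smooth_q
  have hr' := continuousOn_dx_zero hT h.smooth_r
  fin_cases i <;> fin_cases j <;> simp [V₂, V₂one, V₂zero] <;> fun_prop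

/-! ### Coefficients in a basis of solutions, by Cramer's rule -/

theorem SolvesColumns.updateCol {s : Set ℝ} {lam a : Fin 3 → ℂ} {B : ℝ → Mat} {X : ℝ → Mat}
    (h : SolvesColumns s lam B a X) (p : Fin 3) {b : ℂ} {u : ℝ → Fin 3 → ℂ}
    (hu : ∀ x ∈ s, ∀ i, HasDerivWithinAt (fun y => u y i)
      ((lam i - b) * u x i + (B x).mulVec (u x) i) s x) :
    SolvesColumns s lam B (Function.update a p b) (fun x => (X x).updateCol p (u x)) := by
  intro j x hx i
  rcases eq_or_ne j p with rfl | hj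
  · simpa using hu x hx i
  · simpa [Matrix.updateCol_ne hj, Function.update_of_ne hj] using h j x hx i

theorem sum_update (a : Fin 3 → ℂ) (p : Fin 3) (b : ℂ) :
    ∑ i, Function.update a p b i = ∑ i, a i + (b - a p) := by
  rw [Finset.sum_update_of_mem (Finset.mem_univ p),
    ← Finset.add_sum_erase Finset.univ a (Finset.mem_univ p), Finset.sdiff_singleton_eq_erase]
  ring

/-- Liouville's formula for `X` with column `p` replaced by `u`, whose exponents sum to `b - a p`.
When `det X = 1`, the Cramer determinants are the coefficients of `u` in the columns of `X`. -/
theorem SolvesColumns.cramer_const {s : Set ℝ} (hs : Convex ℝ s) {lam a : Fin 3 → ℂ}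
    {B : ℝ → Mat} {X : ℝ → Mat} (h : SolvesColumns s lam B a X) (hlam : ∑ i, lam i = 0)
    (ha : ∑ i, a i = 0) (hB : ∀ x ∈ s, (B x).trace = 0) (p : Fin 3) {b : ℂ} {u : ℝ → Fin 3 → ℂ}
    (hu : ∀ x ∈ s, ∀ i, HasDerivWithinAt (fun y => u y i)
      ((lam i - b) * u x i + (B x).mulVec (u x) i) s x) {x y : ℝ} (hx : x ∈ s) (hy : y ∈ s) :
    (X x).cramer (u x) p * Complex.exp ((b - a p) * x)
      = (X y).cramer (u y) p * Complex.exp ((b - a p) * y) := by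
  have := (h.updateCol p hu).det_const hs hlam hB hx hy
  rwa [sum_update, ha, zero_add] at this

theorem eq_col_of_cramer {X : Mat} (hX : X.det = 1) {v : Fin 3 → ℂ} {c : ℂ} {j : Fin 3}
    (h : ∀ p, X.cramer v p = if p = j then c else 0) (i : Fin 3) : v i = c * X i j := by
  have h1 := X.mulVec_cramer v
  rw [hX, one_smul, funext h] at h1
  rw [← h1]
  simp [Matrix.mulVec, dotProduct, mul_comm]

/-- The pairings say that the row vector `u` times `X` is the `a`-th unit vector, so `u` is a row of
`X⁻¹`, which is the adjugate here. -/
theorem eq_adjugate_of_pairing {X : Mat} (hX : X.det = 1) {u : Fin 3 → ℂ} {a : Fin 3}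
    (h : ∀ j, u ⬝ᵥ (fun i => X i j) = if j = a then 1 else 0) (i : Fin 3) :
    u i = X.adjugate a i := by
  have h1 : Matrix.vecMul u X = Pi.single a 1 := by
    ext j
    rw [Pi.single_apply, ← h j]
    rfl
  have h2 : Matrix.vecMul (Matrix.vecMul u X) X.adjugate = u := by
    rw [Matrix.vecMul_vecMul, Matrix.mul_adjugate, hX, one_smul, Matrix.vecMul_one]
  rw [← h2, h1]
  simp

theorem eq_of_const_of_tendsto {f : ℝ → ℂ} {b : ℂ} (hf : ∀ x, 0 ≤ x → f x = f 0)
    (h : Tendsto f atTop (𝓝 b)) : f 0 = b := by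
  refine tendsto_nhds_unique (tendsto_const_nhds.congr' ?_) h
  filter_upwards [eventually_ge_atTop 0] with x hx using (hf x hx).symm

theorem contoursFit_contour (q r : ℝ → ℝ → ℂ) (k : ℂ) (j : Fin 3) :
    ContoursFit (lax q r k) j (fun i => contour k i j) := by
  intro i
  simp only [contour, lax, Complex.sub_re]
  by_cases h : (l k i).re < (l k j).re
  · refine Or.inr ⟨?_, ?_, by linarith⟩
    · rw [if_pos h]; split_ifs <;> simp
    · rintro rfl; exact lt_irrefl _ h
  · rw [if_neg h]
    exact Or.inl ⟨rfl, by linarith⟩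

/-! ### Comparison of `M` with the other eigenfunctions -/

section Eigenfunctions

variable {T : ℝ} {q r : ℝ → ℝ → ℂ} {k : ℂ} {M : ℝ → ℝ → Mat}

theorem IsM.solvesColumns_x (hM : IsM T q r k M) {t : ℝ} (ht : t ∈ Icc 0 T) :
    SolvesColumns (Ici 0) (l k) (fun x => V₁ q r x t) (l k) (fun x => M x t) :=
  fun j x hx i => (hM j).1.lax_x x t hx ht i

theorem IsM.tendsto_one (hqr : IsSolution T q r) (hM : IsM T q r k M) {t : ℝ}
    (ht : t ∈ Icc 0 T) : Tendsto (fun x => M x t) atTop (𝓝 1) := by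
  refine tendsto_pi_nhds.2 fun i => tendsto_pi_nhds.2 fun j => ?_
  rw [Matrix.one_apply]
  exact (hM j).1.tendsto_atTop (hqr.decays k) (hM j).2 (contoursFit_contour q r k j) ht i

theorem IsM.det_eq_one (hT : 0 ≤ T) (hqr : IsSolution T q r) (hM : IsM T q r k M) :
    (M 0 0).det = 1 := by
  have ht : (0 : ℝ) ∈ Icc 0 T := left_mem_Icc.2 hT
  refine eq_of_const_of_tendsto (f := fun x => (M x 0).det) (fun x hx => ?_) ?_
  · simpa [sum_l] using (hM.solvesColumns_x ht).det_const (convex_Ici 0) (sum_l k)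
      (fun x _ => trace_V₁ q r x 0) hx self_mem_Ici
  · have := ((continuous_id.matrix_det).tendsto (1 : Mat)).comp (hM.tendsto_one hqr ht)
    simpa [Function.comp_def] using this

/-- The coefficient of `w` along column `p` of `M`, times `e^{(l_j - l_p)x}`, is constant in `x`.
The coefficient tends to `δ_pj`, and the exponential decays for `p ≠ j` since `Re l_j` is least; so
the constant is `δ_pj`. -/
theorem IsM.eq_mu₃Col (hT : 0 ≤ T) (hqr : IsSolution T q r) (hM : IsM T q r k M) {j : Fin 3}
    {w : ℝ → ℝ → Fin 3 → ℂ} (hw : IsMu₃Col T q r k j w)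
    (hj : ∀ i, i ≠ j → (l k j).re < (l k i).re) (i : Fin 3) : w 0 0 i = M 0 0 i j := by
  have ht : (0 : ℝ) ∈ Icc 0 T := left_mem_Icc.2 hT
  rw [← one_mul (M 0 0 i j)]
  refine eq_col_of_cramer (hM.det_eq_one hT hqr) (fun p => ?_) i
  have hfit : ContoursFit (lax q r k) j (fun _ => Contour.γ₃) := by
    refine fun i => Or.inl ⟨rfl, ?_⟩
    rcases eq_or_ne i j with rfl | h
    · simp
    · simpa [lax] using (hj i h).le
  have hlim : Tendsto (fun x => w x 0) atTop (𝓝 (Pi.single j 1)) := by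
    refine tendsto_pi_nhds.2 fun i => ?_
    rw [Pi.single_apply]
    exact hw.1.tendsto_atTop (hqr.decays k) hw.2 hfit ht i
  have hcr : Tendsto (fun x => (M x 0).cramer (w x 0) p) atTop (𝓝 (if p = j then 1 else 0)) := by
    have hc : Continuous fun y : Mat × (Fin 3 → ℂ) => (y.1.updateCol p y.2).det :=
      (continuous_fst.matrix_updateCol p continuous_snd).matrix_det
    have := (hc.tendsto (1, Pi.single j 1)).comp ((hM.tendsto_one hqr ht).prodMk_nhds hlim)
    simp only [← Matrix.cramer_apply, Matrix.cramer_one] at this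
    simpa [Pi.single_apply, Function.comp_def] using this
  have := eq_of_const_of_tendsto
    (f := fun x : ℝ => (M x 0).cramer (w x 0) p * Complex.exp ((l k j - l k p) * x))
    (b := if p = j then 1 else 0) (fun x hx => ?_) ?_
  · simpa using this
  · exact (hM.solvesColumns_x ht).cramer_const (convex_Ici 0) (sum_l k) (sum_l k)
      (fun x _ => trace_V₁ q r x 0) p (fun x hx i => hw.1.lax_x x 0 hx ht i) hx self_mem_Ici
  · rcases eq_or_ne p j with rfl | hp
    · simpa using hcr
    · simpa [hp] using hcr.mul (tendsto_exp_mul_atTop (a := l k j - l k p)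
        (by simpa using hj p hp))

/-- The dual comparison: the pairing times `e^{(l_j - l_a)x}` is constant, and this exponential
decays for `j ≠ a` since `Re l_a` is greatest. -/
theorem IsM.pairing_cofactorCol (hT : 0 ≤ T) (hqr : IsSolution T q r) (hM : IsM T q r k M)
    {a : Fin 3} {u : ℝ → ℝ → Fin 3 → ℂ} (hu : IsMu₃CofactorCol T q r k a u)
    (ha : ∀ i, i ≠ a → (l k i).re < (l k a).re) (j : Fin 3) :
    u 0 0 ⬝ᵥ (fun i => M 0 0 i j) = if j = a then 1 else 0 := by
  have ht : (0 : ℝ) ∈ Icc 0 T := left_mem_Icc.2 hT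
  have hfit : ContoursFit (cofactorLax q r k) a (fun _ => Contour.γ₃) := by
    refine fun i => Or.inl ⟨rfl, ?_⟩
    rcases eq_or_ne i a with rfl | h
    · simp
    · simpa [cofactorLax] using (ha i h).le
  have hdot : Tendsto (fun x => u x 0 ⬝ᵥ (fun i => M x 0 i j)) atTop
      (𝓝 (if j = a then 1 else 0)) := by
    have : Tendsto (fun x => ∑ i, u x 0 i * M x 0 i j) atTop
        (𝓝 (∑ i, (if i = a then 1 else 0) * (1 : Mat) i j)) :=
      tendsto_finsetSum _ fun i _ =>
        (hu.1.tendsto_atTop (hqr.cofactor_decays k) hu.2 hfit ht i).mul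
          (tendsto_pi_nhds.1 (tendsto_pi_nhds.1 (hM.tendsto_one hqr ht) i) j)
    simpa [dotProduct, Matrix.one_apply, eq_comm] using this
  have := eq_of_const_of_tendsto
    (f := fun x : ℝ => (u x 0 ⬝ᵥ (fun i => M x 0 i j)) * Complex.exp ((l k j - l k a) * x))
    (b := if j = a then 1 else 0) (fun x hx => ?_) ?_
  · simpa using this
  · refine pairing_const (u := fun x => u x 0) (w := fun x i => M x 0 i j) (convex_Ici 0)
      (fun x hx i => (hu.1.lax_x x 0 hx ht i).congr_deriv ?_)
      (fun x hx i => (hM j).1.lax_x x 0 hx ht i) hx self_mem_Ici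
    simp [cofactorLax, lax]
  · rcases eq_or_ne j a with rfl | hp
    · simpa using hdot
    · simpa [hp] using hdot.mul (tendsto_exp_mul_atTop (a := l k j - l k a)
        (by simpa using ha j hp))

theorem IsMu₁.eq_one {μ : ℝ → ℝ → Mat} (hT : 0 ≤ T) (hμ : IsMu₁ T q r k μ) : μ 0 T = 1 := by
  ext i j
  have := (hμ j).integral_eq 0 T le_rfl (right_mem_Icc.2 hT) i
  simpa [contourIntegral, integralFrom, Matrix.one_apply] using this

theorem IsMu₁.solvesColumns_t {μ : ℝ → ℝ → Mat} (hμ : IsMu₁ T q r k μ) :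
    SolvesColumns (Icc 0 T) (z k) (fun t => V₂ q r k 0 t) (z k) (fun t => μ 0 t) :=
  fun j t ht i => (hμ j).lax_t 0 t le_rfl ht i

theorem IsMu₁.det_eq_one {μ : ℝ → ℝ → Mat} (hT : 0 ≤ T) (hμ : IsMu₁ T q r k μ) :
    (μ 0 0).det = 1 := by
  have := hμ.solvesColumns_t.det_const (convex_Icc 0 T) (sum_z k)
    (fun t _ => trace_V₂ q r k 0 t) (left_mem_Icc.2 hT) (right_mem_Icc.2 hT)
  simpa [sum_z, hμ.eq_one hT] using this

/-- Along `x = 0` the coefficient changes only by a nonzero exponential, and at `t = T` the basis is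
the identity, so the coefficient there is an entry of `M`. -/
theorem IsMu₁.cramer_eq_zero_iff {μ : ℝ → ℝ → Mat} (hT : 0 ≤ T) (hμ : IsMu₁ T q r k μ)
    (hM : IsM T q r k M) (i j : Fin 3) :
    (μ 0 0).cramer (fun p => M 0 0 p j) i = 0 ↔ M 0 T i j = 0 := by
  have := hμ.solvesColumns_t.cramer_const (convex_Icc 0 T) (sum_z k) (sum_z k)
    (fun t _ => trace_V₂ q r k 0 t) i (u := fun t p => M 0 t p j) (b := z k j)
    (fun t ht p => (hM j).1.lax_t 0 t le_rfl ht p) (left_mem_Icc.2 hT) (right_mem_Icc.2 hT)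
  simp only [hμ.eq_one hT, Matrix.cramer_one] at this
  simp only [Complex.ofReal_zero, mul_zero, Complex.exp_zero, mul_one] at this
  rw [this]
  simp [Complex.exp_ne_zero]

theorem IsM.apply_zero_eq_zero (hT : 0 ≤ T) (hM : IsM T q r k M) {i j : Fin 3}
    (hl : (l k i).re < (l k j).re) (hz : (z k i).re < (z k j).re) : M 0 0 i j = 0 := by
  have h := (hM j).1.integral_eq 0 0 le_rfl (left_mem_Icc.2 hT) i
  have hij : i ≠ j := by rintro rfl; exact lt_irrefl _ hl
  simpa [contour, hl, hz, contourIntegral, integralFrom, hij] using h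

theorem IsM.apply_T_eq_zero (hT : 0 ≤ T) (hM : IsM T q r k M) {i j : Fin 3}
    (hl : (l k i).re < (l k j).re) (hz : (z k j).re ≤ (z k i).re) : M 0 T i j = 0 := by
  have h := (hM j).1.integral_eq 0 T le_rfl (right_mem_Icc.2 hT) i
  have hij : i ≠ j := by rintro rfl; exact lt_irrefl _ hl
  simpa [contour, hl, hz.not_gt, contourIntegral, integralFrom, hij] using h

/-- The `j`-th column of `M` may be changed by the multiple `e^{(l_a - l_j) x + (z_a - z_j) t}`
of the `a`-th column. -/
def addColumn (k : ℂ) (M : ℝ → ℝ → Mat) (j a : Fin 3) (x t : ℝ) : Mat :=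
  (M x t).updateCol j fun i => M x t i j +
    Complex.exp ((l k a - l k j) * x + (z k a - z k j) * t) * M x t i a

theorem hasDerivWithinAt_add_exp_mul {s : Set ℝ} {lam : Fin 3 → ℂ} {B : Mat}
    {u w : ℝ → Fin 3 → ℂ} {E : ℝ → ℂ} {a b : ℂ} {x : ℝ} {i : Fin 3}
    (hu : HasDerivWithinAt (fun y => u y i) ((lam i - b) * u x i + B.mulVec (u x) i) s x)
    (hw : HasDerivWithinAt (fun y => w y i) ((lam i - a) * w x i + B.mulVec (w x) i) s x)
    (hE : HasDerivWithinAt E ((a - b) * E x) s x) :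
    HasDerivWithinAt (fun y => u y i + E y * w y i)
      ((lam i - b) * (u x i + E x * w x i) + B.mulVec (fun i => u x i + E x * w x i) i) s x := by
  refine (hu.add (hE.mul hw)).congr_deriv ?_
  have : (fun i => u x i + E x * w x i) = u x + E x • w x := rfl
  rw [this, Matrix.mulVec_add, Matrix.mulVec_smul]
  simp only [Pi.add_apply, Pi.smul_apply, smul_eq_mul]
  ring

theorem hasDerivWithinAt_exp_linear {s : Set ℝ} (a b : ℂ) (x : ℝ) :
    HasDerivWithinAt (fun y : ℝ => Complex.exp (a * y + b)) (a * Complex.exp (a * x + b)) s x := by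
  have h := (((Complex.ofRealCLM.hasDerivAt (x := x)).const_mul a).add_const b).cexp
  refine h.hasDerivWithinAt.congr_deriv ?_
  simp [mul_comm]

/-- The exponential converts the equations of column `a` into those of column `j`. By `hl` the added
term is bounded and vanishes at infinity, so the `γ₃` entries keep their limits; `h₁` and `h₂` keep
the zeros required on `γ₁` and `γ₂`. -/
theorem IsM.addColumn (hT : 0 < T) (hqr : IsSolution T q r) (hM : IsM T q r k M) {j a : Fin 3}
    (hl : (l k a).re < (l k j).re)
    (h₁ : ∀ i, (l k i).re < (l k j).re → (z k j).re ≤ (z k i).re → M 0 T i a = 0)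
    (h₂ : ∀ i, (l k i).re < (l k j).re → (z k i).re < (z k j).re → M 0 0 i a = 0) :
    IsM T q r k (addColumn k M j a) := by
  intro p
  rcases eq_or_ne p j with rfl | hp
  swap
  · have : (fun x t i => Lax3.addColumn k M j a x t i p) = fun x t i => M x t i p := by
      ext x t i; simp [Lax3.addColumn, Matrix.updateCol_ne hp]
    rw [this]; exact hM p
  have hcol : (fun x t i => Lax3.addColumn k M p a x t i p) = fun x t i => M x t i p +
      Complex.exp ((l k a - l k p) * x + (z k a - z k p) * t) * M x t i a := by
    ext x t i; simp [Lax3.addColumn]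
  rw [hcol]
  have hE : ∃ C, ∀ x t : ℝ, 0 ≤ x → t ∈ Icc 0 T →
      ‖Complex.exp ((l k a - l k p) * x + (z k a - z k p) * t)‖ ≤ C := by
    refine ⟨Real.exp (|(z k a - z k p).re| * T), fun x t hx ht => ?_⟩
    rw [Complex.norm_exp, Complex.add_re, Complex.re_mul_ofReal, Complex.re_mul_ofReal]
    refine Real.exp_le_exp.2 ?_
    have h1 : (l k a - l k p).re * x ≤ 0 :=
      mul_nonpos_of_nonpos_of_nonneg (by simpa using hl.le) hx
    have h2 : (z k a - z k p).re * t ≤ |(z k a - z k p).re| * T :=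
      mul_le_mul (le_abs_self _) ht.2 ht.1 (abs_nonneg _)
    linarith
  have hbd : BoundedOn T (fun x t i => M x t i p +
      Complex.exp ((l k a - l k p) * x + (z k a - z k p) * t) * M x t i a) := by
    obtain ⟨C, hC⟩ := hE
    obtain ⟨C₁, hC₁⟩ := (hM p).2
    obtain ⟨C₂, hC₂⟩ := (hM a).2
    refine ⟨C₁ + C * C₂, fun x t hx ht i => (norm_add_le _ _).trans ?_⟩
    rw [norm_mul]
    exact add_le_add (hC₁ x t hx ht i) (mul_le_mul (hC x t hx ht) (hC₂ x t hx ht i)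
      (norm_nonneg _) ((norm_nonneg _).trans (hC x t hx ht)))
  refine ⟨isEigenColumn_of_normalized hT (hqr.decays k) (fun t ht => continuousOn_V₁ hqr ht)
    (continuousOn_V₂ hT hqr k) ?_ ?_ hbd (contoursFit_contour q r k p) ?_, hbd⟩
  · intro x t hx ht i
    exact hasDerivWithinAt_add_exp_mul (u := fun x i => M x t i p) (w := fun x i => M x t i a)
      ((hM p).1.lax_x x t hx ht i) ((hM a).1.lax_x x t hx ht i)
      (hasDerivWithinAt_exp_linear _ _ x)
  · intro x t hx ht i
    have hE' := hasDerivWithinAt_exp_linear (s := Icc 0 T) (z k a - z k p) ((l k a - l k p) * x) t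
    simp only [add_comm _ ((l k a - l k p) * (x : ℂ))] at hE'
    exact hasDerivWithinAt_add_exp_mul (u := fun t i => M x t i p) (w := fun t i => M x t i a)
      ((hM p).1.lax_t x t hx ht i) ((hM a).1.lax_t x t hx ht i) hE'
  · intro i
    by_cases hi : (l k i).re < (l k p).re
    · by_cases hz : (z k i).re < (z k p).re
      · simp [Normalized, contour, hi, hz, h₂ i hi hz, hM.apply_zero_eq_zero hT.le hi hz]
      · simp [Normalized, contour, hi, hz, h₁ i hi (not_lt.1 hz),
          hM.apply_T_eq_zero hT.le hi (not_lt.1 hz)]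
    · simp only [Normalized, contour, if_neg hi]
      intro t ht
      have hlim := fun j => (hM j).1.tendsto_atTop (hqr.decays k) (hM j).2
        (contoursFit_contour q r k j) ht i
      have hexp := (tendsto_exp_mul_atTop (a := l k a - l k p) (by simpa using hl)).mul_const
        (Complex.exp ((z k a - z k p) * t))
      simp only [← Complex.exp_add, zero_mul] at hexp
      simpa using (hlim p).add (hexp.mul (hlim a))

/-- Uniqueness makes the added term vanish at the origin, where the exponential is 1; then column
`a` of a matrix of determinant 1 is zero. -/
theorem Regular.not_addColumn (hT : 0 < T) (hqr : IsSolution T q r) (hreg : Regular T q r k)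
    (hM : IsM T q r k M) {j a : Fin 3} (hl : (l k a).re < (l k j).re)
    (h₁ : ∀ i, (l k i).re < (l k j).re → (z k j).re ≤ (z k i).re → M 0 T i a = 0)
    (h₂ : ∀ i, (l k i).re < (l k j).re → (z k i).re < (z k j).re → M 0 0 i a = 0) : False := by
  have h := hreg.2 _ _ (hM.addColumn hT hqr hl h₁ h₂) hM 0 0 le_rfl (left_mem_Icc.2 hT.le)
  have h0 : ∀ i, M 0 0 i a = 0 := fun i => by
    have := congrFun (congrFun h i) j
    simpa [addColumn] using this
  have hd := hM.det_eq_one hT.le hqr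
  rw [Matrix.det_eq_zero_of_column_eq_zero a h0] at hd
  exact zero_ne_one hd

end Eigenfunctions

/-! ### The cyclic symmetry -/

/-- The cyclic shift `i ↦ i + 1` of the indices. -/
def σ : Equiv.Perm (Fin 3) := Equiv.addRight 1

/-- The coefficients of a Lax pair with permuted indices. -/
def LaxPair.perm (P : LaxPair) (e : Equiv.Perm (Fin 3)) : LaxPair :=
  ⟨P.ℓ ∘ e, P.ζ ∘ e, fun x t => (P.P₁ x t).submatrix e e, fun x t => (P.P₂ x t).submatrix e e⟩

theorem mulVec_perm (B : Mat) (v : Fin 3 → ℂ) (e : Equiv.Perm (Fin 3)) (i : Fin 3) :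
    (B.submatrix e e).mulVec (fun i => v (e i)) i = B.mulVec v (e i) := by
  simp only [Matrix.mulVec, dotProduct, Matrix.submatrix_apply]
  exact Equiv.sum_comp e fun j => B (e i) j * v j

/-- The equations are entrywise, so indices act only as labels and the matrix products are reindexed
sums. -/
theorem IsEigenColumn.perm {P : LaxPair} {T : ℝ} {e : Equiv.Perm (Fin 3)} {j : Fin 3}
    {c : Fin 3 → Contour} {w : ℝ → ℝ → Fin 3 → ℂ} (h : IsEigenColumn P T (e j) c w) :
    IsEigenColumn (P.perm e) T j (fun i => c (e i)) (fun x t i => w x t (e i)) := by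
  refine ⟨fun x t hx ht i => ?_, fun x t hx ht i => ?_, fun x t hx ht i => ?_⟩
  · simp only [LaxPair.perm, mulVec_perm]
    exact h.lax_x x t hx ht (e i)
  · simp only [LaxPair.perm, mulVec_perm]
    exact h.lax_t x t hx ht (e i)
  · rw [h.integral_eq x t hx ht (e i)]
    simp only [EmbeddingLike.apply_eq_iff_eq]
    congr 1
    cases c (e i) <;> simp only [contourIntegral, integralFrom, LaxPair.perm, mulVec_perm] <;> rfl

theorem LaxPair.perm_symm_perm (P : LaxPair) (e : Equiv.Perm (Fin 3)) :
    (P.perm e).perm e.symm = P := by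
  simp [LaxPair.perm, Function.comp_assoc]

theorem l_omega (k : ℂ) (i : Fin 3) : l (ω * k) (σ i) = l k i := by
  fin_cases i <;> simp [l, σ, Jdiag]
  · linear_combination k * omega_pow_three
  · ring
  · ring

theorem z_omega (k : ℂ) (i : Fin 3) : z (ω * k) (σ i) = z k i := by
  have e : ∀ κ j, z κ j = -(l κ j) ^ 2 := fun κ j => by simp [z, l, mul_pow]
  rw [e, e, l_omega]

/-- `V₁` and `V₂zero` are circulant; in `V₂one` the cyclic shift changes each entry by a factor
`ω⁻¹`, which the `ω` in `ω * k` compensates. -/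
theorem lax_omega_perm (q r : ℝ → ℝ → ℂ) (k : ℂ) :
    (lax q r (ω * k)).perm σ = lax q r k := by
  simp only [LaxPair.perm, lax, LaxPair.mk.injEq]
  refine ⟨funext (l_omega k), funext (z_omega k), ?_, ?_⟩
  · ext x t i j
    fin_cases i <;> fin_cases j <;> simp [V₁, σ]
  · ext x t i j
    have h3 := omega_pow_three
    fin_cases i <;> fin_cases j <;> simp [V₂, V₂one, V₂zero, σ] <;> grind

theorem contour_omega (k : ℂ) (i j : Fin 3) : contour (ω * k) (σ i) (σ j) = contour k i j := by
  simp only [contour, l_omega, z_omega]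

theorem isM_omega_iff {T : ℝ} {q r : ℝ → ℝ → ℂ} {k : ℂ} {M : ℝ → ℝ → Mat} :
    IsM T q r (ω * k) M ↔ IsM T q r k (fun x t => (M x t).submatrix σ σ) := by
  constructor
  · refine fun h j => ⟨?_, ?_⟩
    · have := (h (σ j)).1.perm
      simp only [lax_omega_perm, contour_omega] at this
      exact this
    · obtain ⟨C, hC⟩ := (h (σ j)).2
      exact ⟨C, fun x t hx ht i => hC x t hx ht (σ i)⟩
  · refine fun h j => ?_
    obtain ⟨j, rfl⟩ := σ.surjective j
    refine ⟨?_, ?_⟩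
    · have h1 := (h j).1
      rw [← σ.symm_apply_apply j, ← lax_omega_perm] at h1
      have h2 := h1.perm
      rw [LaxPair.perm_symm_perm] at h2
      have e : ∀ i, contour k (σ.symm i) j = contour (ω * k) i (σ j) := fun i => by
        rw [← contour_omega, Equiv.apply_symm_apply]
      simp only [Equiv.symm_apply_apply, e, Matrix.submatrix_apply, Equiv.apply_symm_apply] at h2
      exact h2
    · obtain ⟨C, hC⟩ := (h j).2
      exact ⟨C, fun x t hx ht i => by simpa using hC x t hx ht (σ.symm i)⟩

theorem regular_omega_iff {T : ℝ} {q r : ℝ → ℝ → ℂ} {k : ℂ} :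
    Regular T q r (ω * k) ↔ Regular T q r k := by
  have hback : ∀ M : ℝ → ℝ → Mat, IsM T q r k M →
      IsM T q r (ω * k) fun x t => (M x t).submatrix σ.symm σ.symm := fun M hM => by
    rw [isM_omega_iff]; simpa using hM
  constructor
  · rintro ⟨⟨M, hM⟩, hu⟩
    refine ⟨⟨_, isM_omega_iff.1 hM⟩, fun M M' h h' x t hx ht => ?_⟩
    have := hu _ _ (hback M h) (hback M' h') x t hx ht
    simpa using congrArg (fun X : Mat => X.submatrix σ σ) this
  · rintro ⟨⟨M, hM⟩, hu⟩
    refine ⟨⟨_, hback M hM⟩, fun M M' h h' x t hx ht => ?_⟩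
    have := hu _ _ (isM_omega_iff.1 h) (isM_omega_iff.1 h') x t hx ht
    simpa using congrArg (fun X : Mat => X.submatrix σ.symm σ.symm) this

theorem A_inv : A⁻¹ = !![0, 0, 1; 1, 0, 0; 0, 1, 0] := by
  refine Matrix.inv_eq_left_inv ?_
  ext i j
  fin_cases i <;> fin_cases j <;> simp [A, Matrix.mul_apply, Fin.sum_univ_three]

theorem A_mul_mul_inv (X : Mat) : A * X * A⁻¹ = X.submatrix σ σ := by
  rw [A_inv]
  ext i j
  fin_cases i <;> fin_cases j <;>
    simp [A, Matrix.mul_apply, Matrix.vecMul, dotProduct, Fin.sum_univ_three, σ]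

theorem A_inv_mul_A : A⁻¹ * A = 1 := by
  rw [A_inv]
  ext i j
  fin_cases i <;> fin_cases j <;> simp [A, Matrix.mul_apply, Fin.sum_univ_three]

theorem orderSet_omega (k : ℂ) (a b c d e f : Fin 3) :
    ω * k ∈ orderSet (σ a) (σ b) (σ c) (σ d) (σ e) (σ f) ↔ k ∈ orderSet a b c d e f := by
  simp only [orderSet, mem_ofPred_eq, l_omega, z_omega]

theorem omega_mem_D_iff {n : ℕ} (hn : n ∈ Finset.Icc 1 12) (k : ℂ) :
    ω * k ∈ D (shift n) ↔ k ∈ D n := by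
  rw [Finset.mem_Icc] at hn
  obtain ⟨h1, h2⟩ := hn
  interval_cases n
  · exact orderSet_omega k 2 1 0 0 2 1
  · exact orderSet_omega k 2 1 0 2 0 1
  · exact orderSet_omega k 2 0 1 2 1 0
  · exact orderSet_omega k 2 0 1 1 2 0
  · exact orderSet_omega k 0 2 1 1 0 2
  · exact orderSet_omega k 0 2 1 0 1 2
  · exact orderSet_omega k 0 1 2 0 2 1
  · exact orderSet_omega k 0 1 2 2 0 1
  · exact orderSet_omega k 1 0 2 2 1 0
  · exact orderSet_omega k 1 0 2 1 2 0
  · exact orderSet_omega k 1 2 0 1 0 2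
  · exact orderSet_omega k 1 2 0 0 1 2

theorem shift_of_le {n : ℕ} (hn : n ≤ 8) : shift n = n + 4 := if_pos hn

theorem spectralSn_omega {T : ℝ} (hT : 0 ≤ T) {q r : ℝ → ℝ → ℂ} {Sn : ℕ → ℂ → Mat}
    (hSn : IsSpectralSn T q r Sn) {n : ℕ} (hn : n ∈ Finset.Icc 1 12) {k : ℂ} (hk : k ∈ D n)
    (hreg : Regular T q r k) : Sn n k = A * Sn (shift n) (ω * k) * A⁻¹ := by
  obtain ⟨M, hM, e⟩ := hSn n k hk hreg
  obtain ⟨M', hM', e'⟩ := hSn (shift n) (ω * k) ((omega_mem_D_iff hn k).2 hk)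
    (regular_omega_iff.2 hreg)
  rw [A_mul_mul_inv, e, e']
  exact hreg.2 _ _ hM (isM_omega_iff.1 hM') 0 0 le_rfl (left_mem_Icc.2 hT)

theorem spectralSn_add_four {T : ℝ} (hT : 0 ≤ T) {q r : ℝ → ℝ → ℂ} {Sn : ℕ → ℂ → Mat}
    (hSn : IsSpectralSn T q r Sn) {n : ℕ} (hn : n ∈ Finset.Icc 1 8) {k : ℂ} (hk : k ∈ D (n + 4))
    (hreg : Regular T q r k) : ω⁻¹ * k ∈ D n ∧ Regular T q r (ω⁻¹ * k) ∧
      Sn (n + 4) k = A⁻¹ * Sn n (ω⁻¹ * k) * A := by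
  have hn8 : n ≤ 8 := (Finset.mem_Icc.1 hn).2
  have hn12 : n ∈ Finset.Icc 1 12 := Finset.Icc_subset_Icc_right (by norm_num) hn
  obtain ⟨κ, rfl⟩ : ∃ κ, k = ω * κ := ⟨ω⁻¹ * k, by rw [mul_inv_cancel_left₀ omega_ne_zero]⟩
  rw [← shift_of_le hn8, omega_mem_D_iff hn12] at hk
  rw [regular_omega_iff] at hreg
  rw [inv_mul_cancel_left₀ omega_ne_zero]
  refine ⟨hk, hreg, ?_⟩
  rw [spectralSn_omega hT hSn hn12 hk hreg, ← shift_of_le hn8]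
  rw [← mul_assoc, ← mul_assoc, A_inv_mul_A, one_mul, mul_assoc, A_inv_mul_A, mul_one]

/-! ### The sectors -/

theorem l_neg (k : ℂ) (i : Fin 3) : l (-k) i = -l k i := by simp [l]

theorem z_neg (k : ℂ) (i : Fin 3) : z (-k) i = z k i := by simp [z]

theorem mem_sectorCol_two {k : ℂ} (hk : k ∈ sectorS) : k ∈ sectorCol 2 :=
  ⟨k, hk, by simp [omega_pow_three]⟩

theorem neg_mem_orderSet {k : ℂ} {a b c d e f : Fin 3} (h : k ∈ orderSet a b c d e f) :
    -k ∈ orderSet c b a d e f := by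
  obtain ⟨h1, h2, h3, h4⟩ := h
  simp only [orderSet, mem_ofPred_eq, l_neg, z_neg, Complex.neg_re, neg_lt_neg_iff]
  exact ⟨h2, h1, h3, h4⟩

/-- Negation reverses the order of the `Re l_j` and keeps that of the `Re z_j`: `-D₁ = D₇ = ωD₃` and
`-D₂ = D₈ = ωD₄`. -/
theorem mem_reflSectorCol_zero {k : ℂ} (hk : k ∈ D 1 ∪ D 2) : k ∈ reflSectorCol 0 := by
  obtain ⟨κ, e⟩ : ∃ κ, -k = ω * κ := ⟨ω⁻¹ * -k, by rw [mul_inv_cancel_left₀ omega_ne_zero]⟩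
  refine ⟨κ, ?_, by simpa using e⟩
  rcases hk with hk | hk
  · have := neg_mem_orderSet hk
    rw [e] at this
    exact Or.inl (Or.inr ((orderSet_omega κ 2 0 1 2 1 0).1 this))
  · have := neg_mem_orderSet hk
    rw [e] at this
    exact Or.inr ((orderSet_omega κ 2 0 1 1 2 0).1 this)

/-- Here `-D₃ = D₉ = ω²D₁` and `-D₄ = D₁₀ = ω²D₂`. -/
theorem mem_reflSectorCol_one {k : ℂ} (hk : k ∈ D 3 ∪ D 4) : k ∈ reflSectorCol 1 := by
  obtain ⟨κ, e⟩ : ∃ κ, -k = ω * (ω * κ) :=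
    ⟨ω⁻¹ * (ω⁻¹ * -k), by simp only [mul_inv_cancel_left₀ omega_ne_zero]⟩
  refine ⟨κ, ?_, by rw [e]; simp; ring⟩
  rcases hk with hk | hk
  · have := neg_mem_orderSet hk
    rw [e] at this
    exact Or.inl (Or.inl (Or.inl ((orderSet_omega κ 2 1 0 0 2 1).1
      ((orderSet_omega (ω * κ) 0 2 1 1 0 2).1 this))))
  · have := neg_mem_orderSet hk
    rw [e] at this
    exact Or.inl (Or.inl (Or.inr ((orderSet_omega κ 2 1 0 2 0 1).1
      ((orderSet_omega (ω * κ) 0 2 1 0 1 2).1 this))))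

/-! ### The explicit formulas -/

theorem minor_one_one (X : Mat) : minor X 1 1 = X 0 0 * X 2 2 - X 0 2 * X 2 0 := by
  simp [minor, Matrix.det_fin_two, Fin.succAbove]

theorem minor_zero_one (X : Mat) : minor X 0 1 = X 1 0 * X 2 2 - X 1 2 * X 2 0 := by
  simp [minor, Matrix.det_fin_two, Fin.succAbove]

theorem minor_zero_zero (X : Mat) : minor X 0 0 = X 1 1 * X 2 2 - X 1 2 * X 2 1 := by
  simp [minor, Matrix.det_fin_two]

theorem minor_one_zero (X : Mat) : minor X 1 0 = X 0 1 * X 2 2 - X 0 2 * X 2 1 := by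
  simp [minor, Matrix.det_fin_two, Fin.succAbove]

theorem cramer_one_eq (X : Mat) (v : Fin 3 → ℂ) (hv : v 2 = 0) :
    X.cramer v 1 = v 1 * minor X 1 1 - v 0 * minor X 0 1 := by
  rw [Matrix.cramer_apply, Matrix.det_fin_three, minor_one_one, minor_zero_one]
  simp [hv]
  ring

theorem cramer_zero_eq (X : Mat) (v : Fin 3 → ℂ) (hv : v 2 = 0) :
    X.cramer v 0 = v 0 * minor X 0 0 - v 1 * minor X 1 0 := by
  rw [Matrix.cramer_apply, Matrix.det_fin_three, minor_zero_zero, minor_one_zero]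
  simp [hv]
  ring

theorem W₁_eq (S sA : Mat) : W₁ S sA = (S.transpose * sA) 0 0 := by
  simp [W₁, cofMinor, Matrix.mul_apply, Fin.sum_univ_three]

theorem W₄_eq (S sA : Mat) : W₄ S sA = (S.transpose * sA) 1 1 := by
  simp [W₄, cofMinor, Matrix.mul_apply, Fin.sum_univ_three]
  ring

theorem eq_of_entries {X : Mat} {a b c d e f g h i : ℂ} (h₀₀ : X 0 0 = a) (h₀₁ : X 0 1 = b)
    (h₀₂ : X 0 2 = c) (h₁₀ : X 1 0 = d) (h₁₁ : X 1 1 = e) (h₁₂ : X 1 2 = f) (h₂₀ : X 2 0 = g)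
    (h₂₁ : X 2 1 = h) (h₂₂ : X 2 2 = i) : X = !![a, b, c; d, e, f; g, h, i] := by
  subst_vars
  exact Matrix.eta_fin_three X

section Formulas

variable {T : ℝ} {q r : ℝ → ℝ → ℂ} {k : ℂ} {M : ℝ → ℝ → Mat} {S s sA : ℂ → Mat}

theorem IsM.third_column (hT : 0 ≤ T) (hqr : IsSolution T q r) (hs : IsSpectrals T q r s)
    (hM : IsM T q r k M) (hk : k ∈ sectorS) (h0 : (l k 2).re < (l k 0).re)
    (h1 : (l k 2).re < (l k 1).re) (i : Fin 3) : M 0 0 i 2 = s k i 2 := by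
  obtain ⟨w, hw, e⟩ := hs 2 k (mem_sectorCol_two hk)
  rw [e, hM.eq_mu₃Col hT hqr hw]
  intro i hi
  fin_cases i
  exacts [h0, h1, absurd rfl hi]

theorem IsM.cofactor_column (hT : 0 ≤ T) (hqr : IsSolution T q r) (hsA : IsSpectralsA T q r sA)
    (hM : IsM T q r k M) {a : Fin 3} (hk : k ∈ reflSectorCol a)
    (ha : ∀ i, i ≠ a → (l k i).re < (l k a).re) :
    (∀ j, ∑ i, sA k i a * M 0 0 i j = if j = a then 1 else 0) ∧
      ∀ i, sA k i a = (M 0 0).adjugate a i := by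
  obtain ⟨u, hu, e⟩ := hsA a k hk
  have hp := hM.pairing_cofactorCol hT hqr hu ha
  refine ⟨fun j => ?_, fun i => ?_⟩
  · simp only [e]; exact hp j
  · rw [e]; exact eq_adjugate_of_pairing (hM.det_eq_one hT hqr) hp i

/-- Both lower entries of the first column are on `γ₁`, so this column is a multiple of the first
column of `S`; its pairing with the first cofactor column equals 1, which fixes the multiple as `1 /
W₁`. -/
theorem formula_one (hT : 0 < T) (hqr : IsSolution T q r) (hS : IsSpectralS T q r S)
    (hs : IsSpectrals T q r s) (hsA : IsSpectralsA T q r sA) (hk : k ∈ D 1)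
    (hreg : Regular T q r k) (hM : IsM T q r k M) :
    s k 2 2 ≠ 0 ∧ W₁ (S k) (sA k) ≠ 0 ∧ M 0 0 =
      !![S k 0 0 / W₁ (S k) (sA k), cofMinor (sA k) 1 0 / s k 2 2, s k 0 2;
         S k 1 0 / W₁ (S k) (sA k), cofMinor (sA k) 0 0 / s k 2 2, s k 1 2;
         S k 2 0 / W₁ (S k) (sA k), 0, s k 2 2] := by
  obtain ⟨h1, h2, h3, h4⟩ := id hk
  have hcol := hM.third_column hT.le hqr hs (Or.inl (Or.inl (Or.inl hk))) (h1.trans h2) h1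
  have hmax : ∀ i, i ≠ 0 → (l k i).re < (l k 0).re := by
    intro i hi; fin_cases i
    exacts [absurd rfl hi, h2, h1.trans h2]
  obtain ⟨hpair, hadj⟩ := hM.cofactor_column hT.le hqr hsA (mem_reflSectorCol_zero (Or.inl hk)) hmax
  obtain ⟨μ, hμ, hSμ⟩ := hS k
  have hz21 : M 0 0 2 1 = 0 := hM.apply_zero_eq_zero hT.le h1 h4
  have hs22 : s k 2 2 ≠ 0 := by
    intro h0
    -- The only constrained entry of the second column is the third, on `γ₂`, and the third column
    -- has `s₃₃` there at the origin.
    refine hreg.not_addColumn hT hqr hM (j := 1) (a := 2) h1 ?_ ?_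
    · intro i hi hi'; fin_cases i
      exacts [absurd hi h2.not_gt, absurd hi (lt_irrefl _), absurd hi' h4.not_ge]
    · intro i hi _; fin_cases i
      exacts [absurd hi h2.not_gt, absurd hi (lt_irrefl _), (hcol 2).trans h0]
  have hprop : ∀ i, M 0 0 i 0 = (μ 0 0).cramer (fun p => M 0 0 p 0) 0 * S k i 0 := by
    rw [hSμ]
    refine eq_col_of_cramer (v := fun i => M 0 0 i 0) (hμ.det_eq_one hT.le) fun p => ?_
    fin_cases p
    · rfl
    · exact (hμ.cramer_eq_zero_iff hT.le hM 1 0).2 (hM.apply_T_eq_zero hT.le h2 (h3.trans h4).le)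
    · exact (hμ.cramer_eq_zero_iff hT.le hM 2 0).2
        (hM.apply_T_eq_zero hT.le (h1.trans h2) h3.le)
  generalize (μ 0 0).cramer (fun p => M 0 0 p 0) 0 = c at hprop
  have hW : c * W₁ (S k) (sA k) = 1 := by
    have := hpair 0
    simp only [Fin.sum_univ_three, hprop, if_true] at this
    rw [← this, W₁_eq]
    simp only [Matrix.mul_apply, Fin.sum_univ_three, Matrix.transpose_apply]
    ring
  have hW0 : W₁ (S k) (sA k) ≠ 0 := right_ne_zero_of_mul_eq_one hW
  have hcf : ∀ i, M 0 0 i 0 = S k i 0 / W₁ (S k) (sA k) := fun i => by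
    rw [eq_div_iff hW0, hprop i]; linear_combination S k i 0 * hW
  refine ⟨hs22, hW0, eq_of_entries (hcf 0) ?_ (hcol 0) (hcf 1) ?_ (hcol 1) (hcf 2) hz21 (hcol 2)⟩
  · rw [eq_div_iff hs22, cofMinor, hadj, Matrix.adjugate_fin_three, ← hcol]
    simp [hz21]
  · rw [eq_div_iff hs22, cofMinor, hadj, Matrix.adjugate_fin_three, ← hcol]
    simp [hz21]

/-- The last row of `M(0,0)` is `(0, 0, s₃₃)`. The first column then solves two linear equations,
`det M = 1` and the vanishing of its second coefficient in the columns of `S`; the determinant of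
this system is `W₂` up to sign. -/
theorem formula_two (hT : 0 < T) (hqr : IsSolution T q r) (hS : IsSpectralS T q r S)
    (hs : IsSpectrals T q r s) (hsA : IsSpectralsA T q r sA) (hk : k ∈ D 2)
    (hreg : Regular T q r k) (hM : IsM T q r k M) :
    s k 2 2 ≠ 0 ∧ W₂ (S k) (sA k) ≠ 0 ∧ M 0 0 =
      !![minor (S k) 1 1 / W₂ (S k) (sA k), cofMinor (sA k) 1 0 / s k 2 2, s k 0 2;
         minor (S k) 0 1 / W₂ (S k) (sA k), cofMinor (sA k) 0 0 / s k 2 2, s k 1 2;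
         0, 0, s k 2 2] := by
  obtain ⟨h1, h2, h3, h4⟩ := id hk
  have hcol := hM.third_column hT.le hqr hs (Or.inl (Or.inl (Or.inr hk))) (h1.trans h2) h1
  have hmax : ∀ i, i ≠ 0 → (l k i).re < (l k 0).re := by
    intro i hi; fin_cases i
    exacts [absurd rfl hi, h2, h1.trans h2]
  obtain ⟨-, hadj⟩ := hM.cofactor_column hT.le hqr hsA (mem_reflSectorCol_zero (Or.inr hk)) hmax
  obtain ⟨μ, hμ, hSμ⟩ := hS k
  have hz21 : M 0 0 2 1 = 0 := hM.apply_zero_eq_zero hT.le h1 (h3.trans h4)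
  have hz20 : M 0 0 2 0 = 0 := hM.apply_zero_eq_zero hT.le (h1.trans h2) h3
  have hdet := hM.det_eq_one hT.le hqr
  rw [Matrix.det_fin_three, hz20, hz21] at hdet
  have hs22 : s k 2 2 ≠ 0 := by
    intro h0
    rw [hcol 2, h0] at hdet
    simp at hdet
  have hA0 : cofMinor (sA k) 0 0 = M 0 0 1 1 * s k 2 2 := by
    rw [cofMinor, hadj, Matrix.adjugate_fin_three, ← hcol]
    simp [hz21]
  have hA1 : cofMinor (sA k) 1 0 = M 0 0 0 1 * s k 2 2 := by
    rw [cofMinor, hadj, Matrix.adjugate_fin_three, ← hcol]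
    simp [hz21]
  have hrel : M 0 0 1 0 * minor (S k) 1 1 - M 0 0 0 0 * minor (S k) 0 1 = 0 := by
    rw [← cramer_one_eq (S k) (fun p => M 0 0 p 0) hz20, hSμ]
    exact (hμ.cramer_eq_zero_iff hT.le hM 1 0).2 (hM.apply_T_eq_zero hT.le h2 h4.le)
  have hW0 : W₂ (S k) (sA k) ≠ 0 := by
    intro h0
    -- `W₂` is `s₃₃` times the coefficient of the second column of `M` along the second column of
    -- `S`.
    have hT0 : M 0 T 1 1 = 0 := by
      rw [← hμ.cramer_eq_zero_iff hT.le hM 1 1, ← hSμ, cramer_one_eq _ _ hz21]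
      refine (mul_eq_zero.1 (?_ : s k 2 2 * _ = 0)).resolve_left hs22
      rw [← h0, W₂, hA0, hA1]
      ring
    refine hreg.not_addColumn hT hqr hM (j := 0) (a := 1) h2 ?_ ?_
    · intro i hi hi'; fin_cases i
      exacts [absurd hi (lt_irrefl _), hT0, absurd hi' h3.not_ge]
    · intro i hi hi'; fin_cases i
      exacts [absurd hi (lt_irrefl _), absurd hi' h4.not_gt, hz21]
  rw [hcol 2] at hdet
  refine ⟨hs22, hW0, eq_of_entries ?_ ?_ (hcol 0) ?_ ?_ (hcol 1) hz20 hz21 (hcol 2)⟩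
  · rw [eq_div_iff hW0, W₂, hA0, hA1]
    linear_combination minor (S k) 1 1 * hdet + M 0 0 0 1 * s k 2 2 * hrel
  · rw [eq_div_iff hs22, hA1]
  · rw [eq_div_iff hW0, W₂, hA0, hA1]
    linear_combination minor (S k) 0 1 * hdet + M 0 0 1 1 * s k 2 2 * hrel
  · rw [eq_div_iff hs22, hA0]

/-- `D₃` has the orderings of `D₂` with the first two indices exchanged, and the argument is that of
`formula_two`. -/
theorem formula_three (hT : 0 < T) (hqr : IsSolution T q r) (hS : IsSpectralS T q r S)
    (hs : IsSpectrals T q r s) (hsA : IsSpectralsA T q r sA) (hk : k ∈ D 3)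
    (hreg : Regular T q r k) (hM : IsM T q r k M) :
    s k 2 2 ≠ 0 ∧ W₃ (S k) (sA k) ≠ 0 ∧ M 0 0 =
      !![cofMinor (sA k) 1 1 / s k 2 2, minor (S k) 1 0 / W₃ (S k) (sA k), s k 0 2;
         cofMinor (sA k) 0 1 / s k 2 2, minor (S k) 0 0 / W₃ (S k) (sA k), s k 1 2;
         0, 0, s k 2 2] := by
  obtain ⟨h1, h2, h3, h4⟩ := id hk
  have hcol := hM.third_column hT.le hqr hs (Or.inl (Or.inr hk)) h1 (h1.trans h2)
  have hmax : ∀ i, i ≠ 1 → (l k i).re < (l k 1).re := by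
    intro i hi; fin_cases i
    exacts [h2, absurd rfl hi, h1.trans h2]
  obtain ⟨-, hadj⟩ := hM.cofactor_column hT.le hqr hsA (mem_reflSectorCol_one (Or.inl hk)) hmax
  obtain ⟨μ, hμ, hSμ⟩ := hS k
  have hz20 : M 0 0 2 0 = 0 := hM.apply_zero_eq_zero hT.le h1 (h3.trans h4)
  have hz21 : M 0 0 2 1 = 0 := hM.apply_zero_eq_zero hT.le (h1.trans h2) h3
  have hdet := hM.det_eq_one hT.le hqr
  rw [Matrix.det_fin_three, hz20, hz21] at hdet
  have hs22 : s k 2 2 ≠ 0 := by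
    intro h0
    rw [hcol 2, h0] at hdet
    simp at hdet
  have hA0 : cofMinor (sA k) 0 1 = M 0 0 1 0 * s k 2 2 := by
    rw [cofMinor, hadj, Matrix.adjugate_fin_three, ← hcol]
    simp [hz20]
  have hA1 : cofMinor (sA k) 1 1 = M 0 0 0 0 * s k 2 2 := by
    rw [cofMinor, hadj, Matrix.adjugate_fin_three, ← hcol]
    simp [hz20]
  have hrel : M 0 0 0 1 * minor (S k) 0 0 - M 0 0 1 1 * minor (S k) 1 0 = 0 := by
    rw [← cramer_zero_eq (S k) (fun p => M 0 0 p 1) hz21, hSμ]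
    exact (hμ.cramer_eq_zero_iff hT.le hM 0 1).2 (hM.apply_T_eq_zero hT.le h2 h4.le)
  have hW0 : W₃ (S k) (sA k) ≠ 0 := by
    intro h0
    have hT0 : M 0 T 0 0 = 0 := by
      rw [← hμ.cramer_eq_zero_iff hT.le hM 0 0, ← hSμ, cramer_zero_eq _ _ hz20]
      refine (mul_eq_zero.1 (?_ : s k 2 2 * _ = 0)).resolve_left hs22
      rw [← h0, W₃, hA0, hA1]
      ring
    refine hreg.not_addColumn hT hqr hM (j := 1) (a := 0) h2 ?_ ?_
    · intro i hi hi'; fin_cases i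
      exacts [hT0, absurd hi (lt_irrefl _), absurd hi' h3.not_ge]
    · intro i hi hi'; fin_cases i
      exacts [absurd hi' h4.not_gt, absurd hi (lt_irrefl _), hz20]
  rw [hcol 2] at hdet
  refine ⟨hs22, hW0, eq_of_entries ?_ ?_ (hcol 0) ?_ ?_ (hcol 1) hz20 hz21 (hcol 2)⟩
  · rw [eq_div_iff hs22, hA1]
  · rw [eq_div_iff hW0, W₃, hA0, hA1]
    linear_combination minor (S k) 1 0 * hdet + M 0 0 0 0 * s k 2 2 * hrel
  · rw [eq_div_iff hs22, hA0]
  · rw [eq_div_iff hW0, W₃, hA0, hA1]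
    linear_combination minor (S k) 0 0 * hdet + M 0 0 1 0 * s k 2 2 * hrel

/-- `D₄` has the orderings of `D₁` with the first two indices exchanged, and the argument is that of
`formula_one`. -/
theorem formula_four (hT : 0 < T) (hqr : IsSolution T q r) (hS : IsSpectralS T q r S)
    (hs : IsSpectrals T q r s) (hsA : IsSpectralsA T q r sA) (hk : k ∈ D 4)
    (hreg : Regular T q r k) (hM : IsM T q r k M) :
    s k 2 2 ≠ 0 ∧ W₄ (S k) (sA k) ≠ 0 ∧ M 0 0 =
      !![cofMinor (sA k) 1 1 / s k 2 2, S k 0 1 / W₄ (S k) (sA k), s k 0 2;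
         cofMinor (sA k) 0 1 / s k 2 2, S k 1 1 / W₄ (S k) (sA k), s k 1 2;
         0, S k 2 1 / W₄ (S k) (sA k), s k 2 2] := by
  obtain ⟨h1, h2, h3, h4⟩ := id hk
  have hcol := hM.third_column hT.le hqr hs (Or.inr hk) h1 (h1.trans h2)
  have hmax : ∀ i, i ≠ 1 → (l k i).re < (l k 1).re := by
    intro i hi; fin_cases i
    exacts [h2, absurd rfl hi, h1.trans h2]
  obtain ⟨hpair, hadj⟩ := hM.cofactor_column hT.le hqr hsA (mem_reflSectorCol_one (Or.inr hk)) hmax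
  obtain ⟨μ, hμ, hSμ⟩ := hS k
  have hz20 : M 0 0 2 0 = 0 := hM.apply_zero_eq_zero hT.le h1 h4
  have hs22 : s k 2 2 ≠ 0 := by
    intro h0
    refine hreg.not_addColumn hT hqr hM (j := 0) (a := 2) h1 ?_ ?_
    · intro i hi hi'; fin_cases i
      exacts [absurd hi (lt_irrefl _), absurd hi h2.not_gt, absurd hi' h4.not_ge]
    · intro i hi _; fin_cases i
      exacts [absurd hi (lt_irrefl _), absurd hi h2.not_gt, (hcol 2).trans h0]
  have hprop : ∀ i, M 0 0 i 1 = (μ 0 0).cramer (fun p => M 0 0 p 1) 1 * S k i 1 := by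
    rw [hSμ]
    refine eq_col_of_cramer (v := fun i => M 0 0 i 1) (hμ.det_eq_one hT.le) fun p => ?_
    fin_cases p
    · exact (hμ.cramer_eq_zero_iff hT.le hM 0 1).2 (hM.apply_T_eq_zero hT.le h2 (h3.trans h4).le)
    · rfl
    · exact (hμ.cramer_eq_zero_iff hT.le hM 2 1).2
        (hM.apply_T_eq_zero hT.le (h1.trans h2) h3.le)
  generalize (μ 0 0).cramer (fun p => M 0 0 p 1) 1 = c at hprop
  have hW : c * W₄ (S k) (sA k) = 1 := by
    have := hpair 1
    simp only [Fin.sum_univ_three, hprop, if_true] at this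
    rw [← this, W₄_eq]
    simp only [Matrix.mul_apply, Fin.sum_univ_three, Matrix.transpose_apply]
    ring
  have hW0 : W₄ (S k) (sA k) ≠ 0 := right_ne_zero_of_mul_eq_one hW
  have hcf : ∀ i, M 0 0 i 1 = S k i 1 / W₄ (S k) (sA k) := fun i => by
    rw [eq_div_iff hW0, hprop i]; linear_combination S k i 1 * hW
  refine ⟨hs22, hW0, eq_of_entries ?_ (hcf 0) (hcol 0) ?_ (hcf 1) (hcol 1) hz20 (hcf 2) (hcol 2)⟩
  · rw [eq_div_iff hs22, cofMinor, hadj, Matrix.adjugate_fin_three, ← hcol]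
    simp [hz20]
  · rw [eq_div_iff hs22, cofMinor, hadj, Matrix.adjugate_fin_three, ← hcol]
    simp [hz20]

end Formulas

end Lax3

end

theorem proposition2p3 (T : ℝ) (hT : 0 < T) (q r : ℝ → ℝ → ℂ) (hqr : IsSolution T q r)
    (S s sA : ℂ → Mat) (Sn : ℕ → ℂ → Mat)
    (hS : IsSpectralS T q r S) (hs : IsSpectrals T q r s) (hsA : IsSpectralsA T q r sA)
    (hSn : IsSpectralSn T q r Sn) :
    -- the explicit formulas for `S₁, …, S₄`
    (∀ k ∈ D 1, Regular T q r k → s k 2 2 ≠ 0 ∧ W₁ (S k) (sA k) ≠ 0 ∧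
      Sn 1 k =
        !![S k 0 0 / W₁ (S k) (sA k), cofMinor (sA k) 1 0 / s k 2 2, s k 0 2;
           S k 1 0 / W₁ (S k) (sA k), cofMinor (sA k) 0 0 / s k 2 2, s k 1 2;
           S k 2 0 / W₁ (S k) (sA k), 0, s k 2 2]) ∧
    (∀ k ∈ D 2, Regular T q r k → s k 2 2 ≠ 0 ∧ W₂ (S k) (sA k) ≠ 0 ∧
      Sn 2 k =
        !![minor (S k) 1 1 / W₂ (S k) (sA k), cofMinor (sA k) 1 0 / s k 2 2, s k 0 2;
           minor (S k) 0 1 / W₂ (S k) (sA k), cofMinor (sA k) 0 0 / s k 2 2, s k 1 2;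
           0, 0, s k 2 2]) ∧
    (∀ k ∈ D 3, Regular T q r k → s k 2 2 ≠ 0 ∧ W₃ (S k) (sA k) ≠ 0 ∧
      Sn 3 k =
        !![cofMinor (sA k) 1 1 / s k 2 2, minor (S k) 1 0 / W₃ (S k) (sA k), s k 0 2;
           cofMinor (sA k) 0 1 / s k 2 2, minor (S k) 0 0 / W₃ (S k) (sA k), s k 1 2;
           0, 0, s k 2 2]) ∧
    (∀ k ∈ D 4, Regular T q r k → s k 2 2 ≠ 0 ∧ W₄ (S k) (sA k) ≠ 0 ∧
      Sn 4 k =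
        !![cofMinor (sA k) 1 1 / s k 2 2, S k 0 1 / W₄ (S k) (sA k), s k 0 2;
           cofMinor (sA k) 0 1 / s k 2 2, S k 1 1 / W₄ (S k) (sA k), s k 1 2;
           0, S k 2 1 / W₄ (S k) (sA k), s k 2 2]) ∧
    -- the second expressions for `W₁` and `W₄`
    (∀ k, W₁ (S k) (sA k) = ((S k).transpose * sA k) 0 0 ∧
      W₄ (S k) (sA k) = ((S k).transpose * sA k) 1 1) ∧
    -- the symmetry `S_n(k) = 𝓐 S_{n+4}(ωk) 𝓐⁻¹`, with the index modulo `12`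
    (∀ n ∈ Finset.Icc 1 12, ∀ k, (ω * k ∈ D (shift n) ↔ k ∈ D n) ∧
      (k ∈ D n → (Regular T q r (ω * k) ↔ Regular T q r k) ∧
        (Regular T q r k → Sn n k = A * Sn (shift n) (ω * k) * A⁻¹))) ∧
    -- `S₅, …, S₁₂` in terms of `S₁, …, S₄`
    (∀ n ∈ Finset.Icc 1 4,
      (∀ k ∈ D (n + 4), Regular T q r k →
        ω⁻¹ * k ∈ D n ∧ Regular T q r (ω⁻¹ * k) ∧
          Sn (n + 4) k = A⁻¹ * Sn n (ω⁻¹ * k) * A) ∧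
      (∀ k ∈ D (n + 8), Regular T q r k →
        ω⁻¹ ^ 2 * k ∈ D n ∧ Regular T q r (ω⁻¹ ^ 2 * k) ∧
          Sn (n + 8) k = A⁻¹ ^ 2 * Sn n (ω⁻¹ ^ 2 * k) * A ^ 2)) := by
  have h0 : (0 : ℝ) ≤ T := hT.le
  refine ⟨fun k hk hreg => ?_, fun k hk hreg => ?_, fun k hk hreg => ?_, fun k hk hreg => ?_,
    fun k => ⟨W₁_eq _ _, W₄_eq _ _⟩, fun n hn k => ⟨omega_mem_D_iff hn k, fun hk =>
      ⟨regular_omega_iff, spectralSn_omega h0 hSn hn hk⟩⟩, fun n hn => ⟨fun k hk hreg => ?_,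
      fun k hk hreg => ?_⟩⟩
  · obtain ⟨M, hM, e⟩ := hSn 1 k hk hreg
    rw [e]; exact formula_one hT hqr hS hs hsA hk hreg hM
  · obtain ⟨M, hM, e⟩ := hSn 2 k hk hreg
    rw [e]; exact formula_two hT hqr hS hs hsA hk hreg hM
  · obtain ⟨M, hM, e⟩ := hSn 3 k hk hreg
    rw [e]; exact formula_three hT hqr hS hs hsA hk hreg hM
  · obtain ⟨M, hM, e⟩ := hSn 4 k hk hreg
    rw [e]; exact formula_four hT hqr hS hs hsA hk hreg hM
  · exact spectralSn_add_four h0 hSn (Finset.Icc_subset_Icc_right (by norm_num) hn) hk hreg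
  · rw [Finset.mem_Icc] at hn
    obtain ⟨a1, a2, a3⟩ := spectralSn_add_four h0 hSn (n := n + 4)
      (Finset.mem_Icc.2 (by omega)) hk hreg
    obtain ⟨b1, b2, b3⟩ := spectralSn_add_four h0 hSn (n := n)
      (Finset.mem_Icc.2 (by omega)) a1 a2
    rw [sq ω⁻¹, mul_assoc]
    refine ⟨b1, b2, ?_⟩
    rw [a3, b3, sq, sq]
    simp only [mul_assoc]
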